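/- **Setting.** For a finite-dimensional Hilbert space $\mathcal H$ (for instance $N$ qubits) a *Lindbladian* is a linear map $\mathcal L$ on $\mathcal B(\mathcal H)$ such that $e^{t\mathcal L}$ is completely positive and trace preserving for every $t\ge 0$. Let $\|T\|_{1\to1}=\sup_{Y\ne0}\|T(Y)\|_1/\|Y\|_1$ be the norm induced by the trace norm. Fix constants $t,\delta,C_G>0$ and put $L_0=t\,\delta\,C_G$. An *ensemble with $M$ parameters* consists of a finite-dimensional $\mathcal H$, a reference Lindbladian $\mathcal L_{\rm ref}$, linear maps $G_1,\dots,G_M$ on $\mathcal B(\mathcal H)$ with $\|G_j\|_{1\to1}\le C_G$, a measurable set $\Theta\subseteq S^{M-1}$ of positive surface measure such that $$\mathcal L(\theta)=\mathcal L_{\rm ref}+\frac{\delta}{\sqrt M}\sum_{j=1}^M\theta_jG_j$$ is a Lindbladian for all $\theta\in\Theta$, an input state $\rho_{\rm in}$, and a POVM $\{M_x\}_{x\in X}$ with finite outcome set $X$. Let $\mu_\Theta$ be the normalized restriction of the surface measure to $\Theta$, and let $\mu_{\mathcal L}$ be the law of $\mathcal L(\theta)$ for $\theta\sim\mu_\Theta$.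 Put $P_{\mathcal L}(x)=\operatorname{Tr}(M_x\,e^{t\mathcal L}(\rho_{\rm in}))$, let $Q=\mathbb E_{\mathcal L\sim\mu_{\mathcal L}}P_{\mathcal L}$ be the ensemble average, and let $d_{\rm TV}(P,P')=\frac12\sum_x|P(x)-P'(x)|$. *Lévy concentration with constant $\kappa>0$:* for every $s>0$ and every $K$-Lipschitz $f:\Theta\to\mathbb R$ (Euclidean distance, $K>0$), $\mu_\Theta(|f-\mathbb E f|\ge s)\le 2\exp(-\kappa M s^2/K^2)$. *Mean assumption with $m_0>0$ and $\epsilon_{\rm mean}(M)$:* $\big|\mathbb E_{\mathcal L\sim\mu_{\mathcal L}}\,d_{\rm TV}(P_{\mathcal L},Q)-m_0\big|\le\epsilon_{\rm mean}(M)$. *SQ learning:* for a query $\varphi:X\to[-1,1]$ a valid oracle $\mathrm{Stat}_\tau(P)$ returns a number within $\tau$ of $P[\varphi]=\sum_x\varphi(x)P(x)$. An SQ algorithm chooses its queries adaptively and without computational restrictions, and then outputs a distribution $\widehat P$ on $X$. A deterministic algorithm *$\epsilon$-learns $P$ within $q$ queries* if, for every valid oracle, it makes at most $q$ queries and $d_{\rm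 TV}(\widehat P,P)<\epsilon$. A randomized algorithm (a random deterministic algorithm, measurable in its random seed) *does so with probability at least $\alpha$* if, for every fixed measurable valid oracle, this event has probability at least $\alpha$ over its seed. **Theorem.** (a) There is an absolute constant $\kappa>0$ such that, for all $M\ge1$, Lévy concentration with constant $\kappa$ holds for every measurable $\Theta\subseteq S^{M-1}$ of full surface measure. (b) Let $t,\delta,C_G,\kappa,m_0>0$, let $\epsilon_{\rm mean}(M)\to0$ as $M\to\infty$, and let $\epsilon,\tau>0$ with $2\epsilon+\tau<m_0$, $\alpha>\tfrac12$ and $\beta>0$. Put $c=\kappa\tau^2/L_0^2$. Then there is $M_0$, depending only on these constants and on the sequence $\epsilon_{\rm mean}$, such that the following holds for every $M\ge M_0$ and every ensemble with $M$ parameters that satisfies Lévy concentration with constant $\kappa$ and the mean assumption with $m_0$ and $\epsilon_{\rm mean}(M)$. 1. If a deterministic SQ algorithm $\epsilon$-learns $P_{\mathcal L}$ within $q$ queries of tolerance $\tau$ on a set of Lindbladians $\mathcal L$ of $\mu_{\mathcal L}$-measure at least $\beta$, then $q\ge\frac18\,\beta\,e^{cM}$. 2. If a randomized SQ algorithm,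 on a set of Lindbladians $\mathcal L$ of $\mu_{\mathcal L}$-measure at least $\beta$, $\epsilon$-learns $P_{\mathcal L}$ within $q$ queries of tolerance $\tau$ with probability at least $\alpha$ over its internal randomness, then $q\ge\frac18\,(\alpha-\tfrac12)\,\beta\,e^{cM}$. -/

import Mathlib

open MeasureTheory Filter Topology
open scoped ENNReal NNReal ComplexOrder

/-! ### Superoperators, Lindbladians, trace norm -/

/-- Superoperators: linear maps `B(H) → B(H)` for `H = ℂⁿ`. -/
abbrev SuperOp (n : Type*) [Fintype n] : Type _ := Module.End ℂ (Matrix n n ℂ)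

/-- The trace norm `‖A‖₁ = Tr √(A† A)`, the sum of the singular values of `A`. -/
noncomputable def traceNorm {n : Type*} [Fintype n] [DecidableEq n] (A : Matrix n n ℂ) : ℝ :=
  ∑ i, Real.sqrt ((Matrix.isHermitian_conjTranspose_mul_self A).eigenvalues i)

/-- The induced norm `‖T‖_{1→1} = sup_{Y ≠ 0} ‖T Y‖₁ / ‖Y‖₁`, as an extended nonnegative real. -/
noncomputable def oneToOneNorm {n : Type*} [Fintype n] [DecidableEq n] (T : SuperOp n) : ℝ≥0∞ :=
  ⨆ (Y : Matrix n n ℂ) (_ : Y ≠ 0), ENNReal.ofReal (traceNorm (T Y) / traceNorm Y)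

/-- The map `T ⊗ id_k` on operators of `ℂⁿ ⊗ ℂᵏ`. -/
def ampliation {n : Type*} [Fintype n] (T : SuperOp n) (k : ℕ)
    (Y : Matrix (n × Fin k) (n × Fin k) ℂ) : Matrix (n × Fin k) (n × Fin k) ℂ :=
  Matrix.of fun p q => T (Matrix.of fun i j => Y (i, p.2) (j, q.2)) p.1 q.1

/-- Completely positive and trace preserving. -/
structure IsCPTP {n : Type*} [Fintype n] (T : SuperOp n) : Prop where
  completelyPositive : ∀ (k : ℕ) (Y : Matrix (n × Fin k) (n × Fin k) ℂ),
    Y.PosSemidef → (ampliation T k Y).PosSemidef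
  tracePreserving : ∀ Y : Matrix n n ℂ, (T Y).trace = Y.trace

/-- The element `Λ_t = e^{tL}` of the semigroup generated by `L`. The exponential is computed by
representing superoperators as matrices in the standard basis of matrix units. -/
noncomputable def semigroup {n : Type*} [Fintype n] [DecidableEq n] (L : SuperOp n) (t : ℝ) :
    SuperOp n :=
  (LinearMap.toMatrixAlgEquiv (Matrix.stdBasis ℂ n n)).symm
    (NormedSpace.exp ((t : ℂ) • LinearMap.toMatrixAlgEquiv (Matrix.stdBasis ℂ n n) L))

/-- `L` is a GKSL generator (Lindbladian): `e^{tL}`, `t ≥ 0`, is a semigroup of CPTP maps. -/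
def IsLindbladian {n : Type*} [Fintype n] [DecidableEq n] (L : SuperOp n) : Prop :=
  ∀ t : ℝ, 0 ≤ t → IsCPTP (semigroup L t)

/-! ### Finite distributions and the statistical query model -/

/-- The total variation distance on a finite set. -/
noncomputable def tvDist {X : Type*} [Fintype X] (P Q : X → ℝ) : ℝ :=
  (1 / 2) * ∑ x, |P x - Q x|

/-- Query functions `φ : X → [-1, 1]`. -/
abbrev Query (X : Type*) : Type _ := {φ : X → ℝ // ∀ x, φ x ∈ Set.Icc (-1 : ℝ) 1}

/-- `P[φ]`, the expectation of `φ` under `P`. -/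
def expect {X : Type*} [Fintype X] (P : X → ℝ) (φ : Query X) : ℝ :=
  ∑ x, φ.1 x * P x

/-- `O` is a statistical query oracle `Stat_τ(P)`. -/
def IsStatOracle {X : Type*} [Fintype X] (τ : ℝ) (P : X → ℝ) (O : Query X → ℝ) : Prop :=
  ∀ φ : Query X, |O φ - expect P φ| ≤ τ

/-- A deterministic (adaptive, computationally unbounded) SQ learning algorithm: from the answers
to its first `k` queries it computes either its next query or its final hypothesis, which is a
probability distribution on `X`. -/
abbrev SQAlgorithm (X : Type*) [Fintype X] : Type _ :=
  (k : ℕ) → (Fin k → ℝ) → Query X ⊕ stdSimplex ℝ X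

/-- Run `A` with oracle `O`, starting after the `k` answers `h`, for at most `q` further queries.
The value is the hypothesis, or `none` if `A` wants to make more than `q` further queries. -/
def SQAlgorithm.run {X : Type*} [Fintype X] (A : SQAlgorithm X) (O : Query X → ℝ) :
    (q k : ℕ) → (Fin k → ℝ) → Option (stdSimplex ℝ X)
  | 0, k, h =>
    match A k h with
    | Sum.inl _ => none
    | Sum.inr P => some P
  | q + 1, k, h =>
    match A k h with
    | Sum.inl φ => SQAlgorithm.run A O q (k + 1) (Fin.snoc h (O φ))
    | Sum.inr P => some P

/-- With oracle `O`, `A` makes at most `q` queries and outputs a distribution at total variation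
distance less than `ε` from `P`. -/
def SQAlgorithm.Succeeds {X : Type*} [Fintype X] (A : SQAlgorithm X) (O : Query X → ℝ)
    (ε : ℝ) (q : ℕ) (P : X → ℝ) : Prop :=
  ∃ Phat : stdSimplex ℝ X, SQAlgorithm.run A O q 0 Fin.elim0 = some Phat ∧ tvDist Phat.1 P < ε

/-- The deterministic algorithm `A` `ε`-learns `P` within `q` queries of tolerance `τ`, whatever
valid oracle it is given. -/
def SQAlgorithm.Learns {X : Type*} [Fintype X] (A : SQAlgorithm X) (ε τ : ℝ) (q : ℕ)
    (P : X → ℝ) : Prop :=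
  ∀ O : Query X → ℝ, IsStatOracle τ P O → SQAlgorithm.Succeeds A O ε q P

/-- A randomized SQ learning algorithm with random seed in `Ω`: a deterministic algorithm for each
seed, with jointly measurable dependence on the seed and on the answers received. -/
structure RandomizedSQAlgorithm (Ω X : Type*) [MeasurableSpace Ω] [Fintype X] where
  alg : Ω → SQAlgorithm X
  measurable_alg : ∀ k : ℕ, Measurable fun p : Ω × (Fin k → ℝ) => alg p.1 k p.2

/-- With probability at least `α` over its seed, the randomized algorithm `A` `ε`-learns `P` within
`q` queries of tolerance `τ`. It is only asked to do so for oracles that answer each query in a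
fixed way that does not depend on the seed. -/
def RandomizedSQAlgorithm.Learns {Ω X : Type*} [MeasurableSpace Ω] [Fintype X]
    (A : RandomizedSQAlgorithm Ω X) (ℙ : Measure Ω) (α ε τ : ℝ) (q : ℕ) (P : X → ℝ) : Prop :=
  ∀ O : Query X → ℝ, Measurable O → IsStatOracle τ P O →
    α ≤ ℙ.real {ω | SQAlgorithm.Succeeds (A.alg ω) O ε q P}

/-! ### The parameter sphere and the random Lindbladian ensemble -/

/-- The unit sphere `S^{M-1}` of `ℝ^M` with the Euclidean metric. -/
abbrev ParamSphere (M : ℕ) : Type := Metric.sphere (0 : EuclideanSpace ℝ (Fin M)) 1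

/-- The (unnormalized) rotation invariant surface measure on `S^{M-1}`. -/
noncomputable def surfaceMeasure (M : ℕ) : Measure (ParamSphere M) :=
  (volume : Measure (EuclideanSpace ℝ (Fin M))).toSphere

/-- The uniform probability measure on `Θ ⊆ S^{M-1}`: the normalized restriction of the surface
measure to `Θ`. -/
noncomputable def uniformOn {M : ℕ} (Θ : Set (ParamSphere M)) : Measure (ParamSphere M) :=
  ProbabilityTheory.cond (surfaceMeasure M) Θ

/-- Lévy concentration with constant `κ` on `Θ ⊆ S^{M-1}` with the Euclidean metric and the uniform
measure: `Pr(|f - 𝔼 f| ≥ s) ≤ 2 exp(-κ M s² / K²)` for every `K`-Lipschitz `f : Θ → ℝ`. -/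
def LevyConcentration {M : ℕ} (κ : ℝ) (Θ : Set (ParamSphere M)) : Prop :=
  ∀ (f : ParamSphere M → ℝ) (K : ℝ≥0), 0 < K → LipschitzOnWith K f Θ → ∀ s : ℝ, 0 < s →
    (uniformOn Θ).real {θ | s ≤ |f θ - ∫ θ', f θ' ∂(uniformOn Θ)|} ≤
      2 * Real.exp (-(κ * M * s ^ 2 / (K : ℝ) ^ 2))

/-- A parameter-sphere ensemble of Lindbladians on `ℂⁿ` (for `N` qubits, `n` has `2^N` elements)
with `M` parameters, perturbation strength `δ` and bound `C_G` on the directions, together with the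
interface (input state and POVM) through which it is observed. -/
structure LindbladianEnsemble (n X : Type*) [Fintype n] [DecidableEq n] [Fintype X]
    (M : ℕ) (δ C_G : ℝ) where
  /-- the reference generator -/
  Lref : SuperOp n
  lindbladian_Lref : IsLindbladian Lref
  /-- the directions -/
  G : Fin M → SuperOp n
  norm_G_le : ∀ j, oneToOneNorm (G j) ≤ ENNReal.ofReal C_G
  /-- the admissible parameters -/
  Θ : Set (ParamSphere M)
  measurableSet_Θ : MeasurableSet Θ
  surfaceMeasure_Θ_ne_zero : surfaceMeasure M Θ ≠ 0
  lindbladian_of_mem : ∀ θ ∈ Θ, IsLindbladian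
    (Lref + ((δ / Real.sqrt M : ℝ) : ℂ) • ∑ j, ((θ.1 j : ℝ) : ℂ) • G j)
  /-- the input state -/
  ρ : Matrix n n ℂ
  posSemidef_ρ : ρ.PosSemidef
  trace_ρ : ρ.trace = 1
  /-- the POVM -/
  povm : X → Matrix n n ℂ
  posSemidef_povm : ∀ x, (povm x).PosSemidef
  sum_povm : ∑ x, povm x = 1

namespace LindbladianEnsemble

variable {n X : Type*} [Fintype n] [DecidableEq n] [Fintype X] {M : ℕ} {δ C_G : ℝ}

/-- `L(θ) = L_ref + (δ / √M) ∑ⱼ θⱼ Gⱼ`. -/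
noncomputable def L (E : LindbladianEnsemble n X M δ C_G) (θ : ParamSphere M) : SuperOp n :=
  E.Lref + ((δ / Real.sqrt M : ℝ) : ℂ) • ∑ j, ((θ.1 j : ℝ) : ℂ) • E.G j

/-- The law `μ_Θ` of the parameter. Drawing `L` from the ensemble means drawing `θ` from `μ_Θ` and
taking `L = L(θ)`. -/
noncomputable def μ (E : LindbladianEnsemble n X M δ C_G) : Measure (ParamSphere M) :=
  uniformOn E.Θ

/-- The output distribution `P_{L(θ)}(x) = Tr(M_x e^{t L(θ)}(ρ))` at time `t`. -/
noncomputable def outDist (E : LindbladianEnsemble n X M δ C_G) (t : ℝ) (θ : ParamSphere M) :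
    X → ℝ :=
  fun x => (E.povm x * semigroup (E.L θ) t E.ρ).trace.re

/-- The ensemble average `Q` of the output distributions. -/
noncomputable def avgDist (E : LindbladianEnsemble n X M δ C_G) (t : ℝ) : X → ℝ :=
  fun x => ∫ θ, E.outDist t θ x ∂E.μ

/-- The mean total variation distance `𝔼 d_TV(P_L, Q)` to the ensemble average. -/
noncomputable def meanTV (E : LindbladianEnsemble n X M δ C_G) (t : ℝ) : ℝ :=
  ∫ θ, tvDist (E.outDist t θ) (E.avgDist t) ∂E.μ

end LindbladianEnsemble

/-!
By Duhamel's formula and the duality between the trace norm and the operator norm, every query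
value `P_{L(θ)}[φ]` is a Lipschitz function of `θ` with constant `t δ C_G`: the Heisenberg duals
of the channels `e^{sL}` preserve the observables between `-1` and `1`, and Cauchy–Schwarz turns
`∑ |θⱼ - θ'ⱼ|` into `√M ‖θ - θ'‖`. Lévy concentration then puts each query value within `τ` of
`Q[φ]`, and `d_TV(P, Q)` within `τ / 2` of its mean, up to a set of parameters of measure
`η = 2 e^{-cM}`. Consequently no fixed hypothesis is `ε`-close to `P` on a set of measure larger
than `η`.

An oracle for `P` may answer `Q[φ]` as long as this is within its tolerance. Against it a
deterministic algorithm follows one and the same path for all `P`, until a query on this path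
separates `P` from `Q`; a union bound along the path shows that learning succeeds only on a set
of measure `(q + 1) η`. For randomized algorithms this bound is averaged over the seed and
combined with Markov's inequality.

Concentration on the sphere comes from the Gaussian one: a Gaussian vector is the product of its
norm and an independent uniform direction, and the mean of its norm is of order `√M`.
-/

section Subgaussian

open ProbabilityTheory

variable {α β : Type*} [MeasurableSpace α] [MeasurableSpace β] {μ : Measure α} {ν : Measure β}
  {Z : α × β → ℝ} {c : ℝ≥0}

theorem hasSubgaussianMGF_prod_of_ae_hasSubgaussianMGF [IsProbabilityMeasure μ] [SFinite ν]
    (hZ : AEStronglyMeasurable Z (μ.prod ν))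
    (h : ∀ᵐ a ∂μ, HasSubgaussianMGF (fun b ↦ Z (a, b)) c ν) :
    HasSubgaussianMGF Z c (μ.prod ν) := by
  have mgf_section_le (t : ℝ) :
      ∀ᵐ a ∂μ, ∫ b, Real.exp (t * Z (a, b)) ∂ν ≤ Real.exp (c * t ^ 2 / 2) := by
    filter_upwards [h] with a ha using ha.mgf_le t
  have integrable_exp (t : ℝ) : Integrable (fun p ↦ Real.exp (t * Z p)) (μ.prod ν) := by
    have hmeas := Real.continuous_exp.comp_aestronglyMeasurable (hZ.const_mul t)
    refine (integrable_prod_iff hmeas).2 ⟨h.mono fun a ha ↦ ha.integrable_exp_mul t, ?_⟩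
    refine (integrable_const (Real.exp (c * t ^ 2 / 2))).mono'
      hmeas.norm.integral_prod_right' ?_
    filter_upwards [mgf_section_le t] with a ha
    simp only [Real.norm_eq_abs, Real.abs_exp]
    rwa [abs_of_nonneg (by positivity)]
  refine ⟨integrable_exp, fun t ↦ ?_⟩
  calc mgf Z (μ.prod ν) t = ∫ a, ∫ b, Real.exp (t * Z (a, b)) ∂ν ∂μ :=
        integral_prod _ (integrable_exp t)
    _ ≤ ∫ _, Real.exp (c * t ^ 2 / 2) ∂μ :=
        integral_mono_ae (integrable_exp t).integral_prod_left (integrable_const _)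
          (mgf_section_le t)
    _ = Real.exp (c * t ^ 2 / 2) := by simp

theorem hasSubgaussianMGF_integral_left [IsProbabilityMeasure μ] [SFinite ν]
    (h : HasSubgaussianMGF Z c (μ.prod ν)) :
    HasSubgaussianMGF (fun b ↦ ∫ a, Z (a, b) ∂μ) c ν := by
  have jensen (t : ℝ) : ∀ᵐ b ∂ν,
      Real.exp (t * ∫ a, Z (a, b) ∂μ) ≤ ∫ a, Real.exp (t * Z (a, b)) ∂μ := by
    filter_upwards [h.integrable.prod_left_ae, (h.integrable_exp_mul t).prod_left_ae]
      with b hb hexp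
    rw [← integral_const_mul]
    exact convexOn_exp.map_integral_le Real.continuous_exp.continuousOn isClosed_univ
      (ae_of_all _ fun _ ↦ Set.mem_univ _) (hb.const_mul t) hexp
  have integrable_mgf (t : ℝ) := (h.integrable_exp_mul t).integral_prod_right
  have integrable_exp (t : ℝ) : Integrable (fun b ↦ Real.exp (t * ∫ a, Z (a, b) ∂μ)) ν := by
    refine (integrable_mgf t).mono' (Real.continuous_exp.comp_aestronglyMeasurable
      (h.integrable.integral_prod_right.aestronglyMeasurable.const_mul t)) ?_
    filter_upwards [jensen t] with b hb
    rwa [Real.norm_eq_abs, Real.abs_exp]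
  refine ⟨integrable_exp, fun t ↦ ?_⟩
  calc mgf (fun b ↦ ∫ a, Z (a, b) ∂μ) ν t
      ≤ ∫ b, ∫ a, Real.exp (t * Z (a, b)) ∂μ ∂ν :=
        integral_mono_ae (integrable_exp t) (integrable_mgf t) (jensen t)
    _ = mgf Z (μ.prod ν) t := (integral_prod_symm _ (h.integrable_exp_mul t)).symm
    _ ≤ Real.exp (c * t ^ 2 / 2) := h.mgf_le t

theorem hasSubgaussianMGF_of_le {X : α → ℝ} {c' : ℝ≥0} (h : HasSubgaussianMGF X c μ) (hc : c ≤ c') :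
    HasSubgaussianMGF X c' μ :=
  ⟨h.integrable_exp_mul, fun t ↦ (h.mgf_le t).trans (by gcongr)⟩

theorem measureReal_le_abs_le_of_hasSubgaussianMGF {X : α → ℝ} [IsFiniteMeasure μ]
    (h : HasSubgaussianMGF X c μ) {s : ℝ} (hs : 0 ≤ s) :
    μ.real {a | s ≤ |X a|} ≤ 2 * Real.exp (-s ^ 2 / (2 * c)) := by
  calc μ.real {a | s ≤ |X a|} ≤ μ.real ({a | s ≤ X a} ∪ {a | s ≤ (-X) a}) := by
        refine measureReal_mono fun a (ha : s ≤ |X a|) ↦ ?_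
        exact le_abs.1 ha
    _ ≤ μ.real {a | s ≤ X a} + μ.real {a | s ≤ (-X) a} := measureReal_union_le _ _
    _ ≤ 2 * Real.exp (-s ^ 2 / (2 * c)) := by
        linarith [h.measure_ge_le hs, h.neg.measure_ge_le hs]

end Subgaussian

section GaussianConcentration

open ProbabilityTheory Real
open scoped RealInnerProductSpace

variable {E : Type*} [NormedAddCommGroup E] [InnerProductSpace ℝ E] [FiniteDimensional ℝ E]
  [MeasurableSpace E] [BorelSpace E]

theorem integral_exp_neg_half_sq_norm :
    ∫ x : E, rexp (-(1 / 2) * ‖x‖ ^ 2) = (2 * π) ^ (Module.finrank ℝ E / 2 : ℝ) := by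
  rw [GaussianFourier.integral_rexp_neg_mul_sq_norm (by norm_num)]
  congr 1
  ring

theorem integral_exp_neg_half_sq_norm_add_inner (t : E) :
    ∫ x : E, Complex.exp (-(1 / 2) * (‖x‖ : ℂ) ^ 2 + Complex.I * ⟪t, x⟫) =
      ((2 * π : ℝ) ^ (Module.finrank ℝ E / 2 : ℝ) : ℝ) * Complex.exp (-(‖t‖ : ℂ) ^ 2 / 2) := by
  rw [GaussianFourier.integral_cexp_neg_mul_sq_norm_add (by norm_num),
    Complex.ofReal_cpow (by positivity), Complex.I_sq]
  push_cast
  congr 2 <;> ring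

theorem stdGaussian_eq_withDensity :
    stdGaussian E = volume.withDensity fun x ↦ ENNReal.ofReal
      (((2 * π) ^ (Module.finrank ℝ E / 2 : ℝ))⁻¹ * rexp (-(1 / 2) * ‖x‖ ^ 2)) := by
  set Z : ℝ := (2 * π) ^ (Module.finrank ℝ E / 2 : ℝ) with hZ
  have hZ₀ : 0 < Z := by positivity
  have integrable_density : Integrable fun x : E ↦ Z⁻¹ * rexp (-(1 / 2) * ‖x‖ ^ 2) :=
    (Integrable.of_integral_ne_zero (integral_exp_neg_half_sq_norm.trans_ne hZ₀.ne')).const_mul _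
  have := isFiniteMeasure_withDensity_ofReal integrable_density.2
  refine Measure.ext_of_charFun (funext fun t ↦ ?_)
  have density_smul (x : E) :
      (ENNReal.ofReal (Z⁻¹ * rexp (-(1 / 2) * ‖x‖ ^ 2))).toReal • Complex.exp (⟪x, t⟫ * Complex.I) =
        (Z⁻¹ : ℂ) * Complex.exp (-(1 / 2) * (‖x‖ : ℂ) ^ 2 + Complex.I * ⟪t, x⟫) := by
    rw [ENNReal.toReal_ofReal (by positivity), Complex.real_smul, Complex.exp_add, real_inner_comm]
    push_cast
    ring_nf
  rw [charFun_stdGaussian, charFun_apply,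
    integral_withDensity_eq_integral_toReal_smul (by fun_prop) (by simp)]
  simp_rw [density_smul]
  rw [integral_const_mul, integral_exp_neg_half_sq_norm_add_inner, ← hZ,
    inv_mul_cancel_left₀ (by exact_mod_cast hZ₀.ne')]

theorem stdGaussian_absolutelyContinuous : stdGaussian E ≪ (volume : Measure E) :=
  stdGaussian_eq_withDensity (E := E) ▸ withDensity_absolutelyContinuous _ _

theorem hasSubgaussianMGF_strongDual_stdGaussian (L : StrongDual ℝ E) :
    HasSubgaussianMGF L (‖L‖₊ ^ 2) (stdGaussian E) := by
  have map_L : (stdGaussian E).map L = gaussianReal 0 (‖L‖₊ ^ 2) := by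
    rw [IsGaussian.map_eq_gaussianReal L, integral_strongDual_stdGaussian,
      variance_dual_stdGaussian]
    simp [Real.toNNReal_pow]
  rw [← HasSubgaussianMGF.id_map_iff (by fun_prop), map_L]
  exact ⟨fun t ↦ integrable_exp_mul_gaussianReal t, fun t ↦ by simp [mgf_id_gaussianReal]⟩

theorem measurePreserving_rotation_stdGaussian (θ : ℝ) :
    MeasurePreserving (ContinuousLinearMap.rotation θ) ((stdGaussian E).prod (stdGaussian E))
      ((stdGaussian E).prod (stdGaussian E)) :=
  ⟨by fun_prop, IsGaussian.map_rotation_eq_self (by simp) θ⟩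

theorem measurable_fderiv_apply_prod (F : E → ℝ) :
    Measurable fun p : E × E ↦ fderiv ℝ F p.1 p.2 :=
  have : ProperSpace (E →L[ℝ] ℝ) := FiniteDimensional.proper ℝ _
  (isBoundedBilinearMap_apply (𝕜 := ℝ) (E := E) (F := ℝ)).continuous.measurable.comp
    (((measurable_fderiv ℝ F).comp measurable_fst).prodMk measurable_snd)

theorem hasSubgaussianMGF_fderiv_of_lipschitzWith {F : E → ℝ} {K : ℝ≥0}
    (hF : LipschitzWith K F) :
    HasSubgaussianMGF (fun p : E × E ↦ fderiv ℝ F p.1 p.2) (K ^ 2)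
      ((stdGaussian E).prod (stdGaussian E)) := by
  refine hasSubgaussianMGF_prod_of_ae_hasSubgaussianMGF
    (measurable_fderiv_apply_prod F).aestronglyMeasurable (ae_of_all _ fun x ↦ ?_)
  have hK : ‖fderiv ℝ F x‖₊ ≤ K := norm_fderiv_le_of_lipschitz ℝ hF
  have hx := hasSubgaussianMGF_strongDual_stdGaussian (fderiv ℝ F x)
  exact hasSubgaussianMGF_of_le hx (by gcongr)

omit [FiniteDimensional ℝ E] [MeasurableSpace E] [BorelSpace E] in
theorem hasDerivAt_rotation_fst (p : E × E) (θ : ℝ) :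
    HasDerivAt (fun θ ↦ (ContinuousLinearMap.rotation θ p).1)
      (ContinuousLinearMap.rotation θ p).2 θ := by
  simp only [ContinuousLinearMap.rotation_apply]
  exact ((hasDerivAt_cos θ).smul_const p.1).add ((hasDerivAt_sin θ).smul_const p.2)

omit [FiniteDimensional ℝ E] [MeasurableSpace E] [BorelSpace E] in
theorem lipschitzWith_rotation_fst (p : E × E) :
    LipschitzWith (‖p.1‖₊ + ‖p.2‖₊) fun θ ↦ (ContinuousLinearMap.rotation θ p).1 := by
  refine lipschitzWith_of_nnnorm_deriv_le
    (fun θ ↦ (hasDerivAt_rotation_fst p θ).differentiableAt) fun θ ↦ ?_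
  rw [(hasDerivAt_rotation_fst p θ).deriv, ContinuousLinearMap.rotation_apply, ← NNReal.coe_le_coe]
  push_cast
  refine (norm_add_le _ _).trans ?_
  rw [norm_smul, norm_smul, norm_neg, norm_eq_abs, norm_eq_abs]
  exact add_le_add (mul_le_of_le_one_left (norm_nonneg _) (abs_sin_le_one θ))
    (mul_le_of_le_one_left (norm_nonneg _) (abs_cos_le_one θ))

/-- The uniform distribution on `(0, π / 2]`, the law of the random angle used to interpolate
between two independent Gaussian vectors. -/
noncomputable def uniformAngle : Measure ℝ := (volume : Measure ℝ)[|Set.Ioc 0 (π / 2)]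

instance : IsProbabilityMeasure uniformAngle :=
  cond_isProbabilityMeasure_of_finite (by simp [pi_pos]) (by simp)

theorem integral_uniformAngle (f : ℝ → ℝ) :
    ∫ θ, f θ ∂uniformAngle = (π / 2)⁻¹ * ∫ θ in 0..π / 2, f θ := by
  rw [uniformAngle, ProbabilityTheory.cond, integral_smul_measure,
    intervalIntegral.integral_of_le (by positivity)]
  simp [ENNReal.toReal_inv, ENNReal.toReal_ofReal pi_div_two_pos.le]

theorem measurePreserving_uniformAngle_rotation :
    MeasurePreserving (fun a : ℝ × E × E ↦ ContinuousLinearMap.rotation a.1 a.2)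
      (uniformAngle.prod ((stdGaussian E).prod (stdGaussian E)))
      ((stdGaussian E).prod (stdGaussian E)) := by
  have hmeas : Measurable fun a : ℝ × E × E ↦ ContinuousLinearMap.rotation a.1 a.2 := by
    simp only [ContinuousLinearMap.rotation_apply]
    fun_prop
  exact measurePreserving_snd.comp ((MeasurePreserving.id uniformAngle).skew_product hmeas
    (ae_of_all _ fun θ ↦ (measurePreserving_rotation_stdGaussian θ).map_eq))

omit [FiniteDimensional ℝ E] [MeasurableSpace E] [BorelSpace E] in
theorem sub_eq_integral_fderiv_rotation {F : E → ℝ} {K : ℝ≥0} (hF : LipschitzWith K F) {p : E × E}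
    (hp : ∀ᵐ θ ∂uniformAngle, DifferentiableAt ℝ F (ContinuousLinearMap.rotation θ p).1) :
    F p.2 - F p.1 = ∫ θ, π / 2 * fderiv ℝ F (ContinuousLinearMap.rotation θ p).1
      (ContinuousLinearMap.rotation θ p).2 ∂uniformAngle := by
  have ftc := ((hF.comp (lipschitzWith_rotation_fst p)).lipschitzOnWith
    (s := Set.uIcc 0 (π / 2))).absolutelyContinuousOnInterval.integral_deriv_eq_sub
  simp only [Function.comp_apply, ContinuousLinearMap.rotation_apply, cos_zero, sin_zero,
    cos_pi_div_two, sin_pi_div_two, one_smul, zero_smul, add_zero, zero_add] at ftc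
  have deriv_eq : ∀ᵐ θ ∂uniformAngle, deriv (F ∘ fun θ ↦ (ContinuousLinearMap.rotation θ p).1) θ =
      fderiv ℝ F (ContinuousLinearMap.rotation θ p).1 (ContinuousLinearMap.rotation θ p).2 :=
    hp.mono fun θ hθ ↦ (hθ.hasFDerivAt.comp_hasDerivAt θ (hasDerivAt_rotation_fst p θ)).deriv
  rw [integral_const_mul, ← integral_congr_ae deriv_eq, integral_uniformAngle,
    mul_inv_cancel_left₀ (by positivity), ← ftc]
  simp only [ContinuousLinearMap.rotation_apply, Function.comp_def]

theorem ae_ae_differentiableAt_rotation_fst {F : E → ℝ} {K : ℝ≥0} (hF : LipschitzWith K F) :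
    ∀ᵐ p ∂(stdGaussian E).prod (stdGaussian E), ∀ᵐ θ ∂uniformAngle,
      DifferentiableAt ℝ F (ContinuousLinearMap.rotation θ p).1 := by
  have : ∀ᵐ x ∂stdGaussian E, DifferentiableAt ℝ F x :=
    stdGaussian_absolutelyContinuous.ae_le hF.ae_differentiableAt
  exact Measure.ae_ae_of_ae_prod (Measure.measurePreserving_swap.quasiMeasurePreserving.ae
    (measurePreserving_uniformAngle_rotation.quasiMeasurePreserving.ae
      (Measure.quasiMeasurePreserving_fst.ae this)))

/-- The Maurey–Pisier argument: rotating `p.1` into `p.2` writes `F p.2 - F p.1` as the average over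
the angle of `π / 2` times a derivative of `F` along a pair which, for every fixed angle, is again a
pair of independent standard Gaussian vectors. -/
theorem hasSubgaussianMGF_sub_of_lipschitzWith {F : E → ℝ} {K : ℝ≥0} (hF : LipschitzWith K F) :
    HasSubgaussianMGF (fun p : E × E ↦ F p.2 - F p.1) ((NNReal.pi / 2 * K) ^ 2)
      ((stdGaussian E).prod (stdGaussian E)) := by
  have hderiv := (hasSubgaussianMGF_fderiv_of_lipschitzWith hF).const_mul (π / 2)
  rw [← measurePreserving_uniformAngle_rotation.map_eq] at hderiv
  have havg := hasSubgaussianMGF_integral_left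
    (hderiv.of_map measurePreserving_uniformAngle_rotation.aemeasurable)
  rw [mul_pow]
  refine havg.congr ?_
  filter_upwards [ae_ae_differentiableAt_rotation_fst hF] with p hp
  exact (sub_eq_integral_fderiv_rotation hF hp).symm

theorem integrable_stdGaussian_of_lipschitzWith {F : E → ℝ} {K : ℝ≥0} (hF : LipschitzWith K F) :
    Integrable F (stdGaussian E) := by
  obtain ⟨x, hx⟩ := (hasSubgaussianMGF_sub_of_lipschitzWith hF).integrable.prod_right_ae.exists
  exact (hx.add (integrable_const (F x))).congr (ae_of_all _ fun y ↦ sub_add_cancel (F y) (F x))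

theorem hasSubgaussianMGF_sub_integral_of_lipschitzWith {F : E → ℝ} {K : ℝ≥0}
    (hF : LipschitzWith K F) :
    HasSubgaussianMGF (fun x ↦ F x - ∫ y, F y ∂stdGaussian E) ((NNReal.pi / 2 * K) ^ 2)
      (stdGaussian E) := by
  refine (hasSubgaussianMGF_integral_left (hasSubgaussianMGF_sub_of_lipschitzWith hF)).congr
    (ae_of_all _ fun y ↦ ?_)
  simp [integral_sub (integrable_const (F y)) (integrable_stdGaussian_of_lipschitzWith hF)]

end GaussianConcentration

section SphereConcentration

open ProbabilityTheory Real Metric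

section Normed

variable {E : Type*} [NormedAddCommGroup E] [NormedSpace ℝ E]

theorem norm_mul_norm_normalize_sub_normalize_le {x y : E} (hx : x ≠ 0) (hy : y ≠ 0) :
    ‖y‖ * ‖‖x‖⁻¹ • x - ‖y‖⁻¹ • y‖ ≤ 2 * ‖x - y‖ := by
  have hx' : ‖x‖ ≠ 0 := norm_ne_zero_iff.2 hx
  have hy' : ‖y‖ ≠ 0 := norm_ne_zero_iff.2 hy
  calc ‖y‖ * ‖‖x‖⁻¹ • x - ‖y‖⁻¹ • y‖ = ‖‖y‖ • (‖x‖⁻¹ • x - ‖y‖⁻¹ • y)‖ := by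
        rw [norm_smul, norm_norm]
    _ = ‖(‖y‖ - ‖x‖) • ‖x‖⁻¹ • x + (x - y)‖ := by
        rw [smul_sub, sub_smul, smul_inv_smul₀ hx', smul_inv_smul₀ hy', sub_add_sub_cancel]
    _ ≤ |‖y‖ - ‖x‖| * ‖‖x‖⁻¹ • x‖ + ‖x - y‖ := by
        simpa only [norm_smul, Real.norm_eq_abs] using
          norm_add_le ((‖y‖ - ‖x‖) • ‖x‖⁻¹ • x) (x - y)
    _ ≤ 2 * ‖x - y‖ := by
        rw [norm_smul, norm_inv, norm_norm, inv_mul_cancel₀ hx', abs_sub_comm]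
        linarith [abs_norm_sub_norm_le x y]

theorem lipschitzWith_norm_mul_comp_normalize {F : E → ℝ} {K B : ℝ≥0}
    (hF : LipschitzOnWith K F (sphere 0 1)) (hB : ∀ u ∈ sphere (0 : E) 1, |F u| ≤ B) :
    LipschitzWith (B + 2 * K) fun x ↦ ‖x‖ * F (‖x‖⁻¹ • x) := by
  have normalize_mem {x : E} (hx : x ≠ 0) : ‖x‖⁻¹ • x ∈ sphere (0 : E) 1 := by
    simp [norm_smul, hx]
  have abs_le (x : E) : |‖x‖ * F (‖x‖⁻¹ • x)| ≤ (B + 2 * K) * ‖x‖ := by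
    rcases eq_or_ne x 0 with rfl | hx
    · simp
    rw [abs_mul, abs_norm, mul_comm]
    gcongr
    exact (hB _ (normalize_mem hx)).trans (by simp)
  refine LipschitzWith.of_dist_le_mul fun x y ↦ ?_
  rw [Real.dist_eq, dist_eq_norm]
  push_cast
  rcases eq_or_ne x 0 with rfl | hx
  · simpa using abs_le y
  rcases eq_or_ne y 0 with rfl | hy
  · simpa using abs_le x
  set u := ‖x‖⁻¹ • x
  set v := ‖y‖⁻¹ • y
  have hFuv : |F u - F v| ≤ K * ‖u - v‖ := by
    simpa [Real.dist_eq, dist_eq_norm] using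
      hF.dist_le_mul u (normalize_mem hx) v (normalize_mem hy)
  calc |‖x‖ * F u - ‖y‖ * F v| = |(‖x‖ - ‖y‖) * F u + ‖y‖ * (F u - F v)| := by ring_nf
    _ ≤ |‖x‖ - ‖y‖| * |F u| + ‖y‖ * |F u - F v| := by
        simpa only [abs_mul, abs_norm] using abs_add_le ((‖x‖ - ‖y‖) * F u) (‖y‖ * (F u - F v))
    _ ≤ ‖x - y‖ * B + ‖y‖ * (K * ‖u - v‖) := by
        gcongr
        · exact abs_norm_sub_norm_le x y
        · exact hB u (normalize_mem hx)
    _ = B * ‖x - y‖ + K * (‖y‖ * ‖u - v‖) := by ring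
    _ ≤ B * ‖x - y‖ + K * (2 * ‖x - y‖) := by
        gcongr B * ‖x - y‖ + K * ?_
        exact norm_mul_norm_normalize_sub_normalize_le hx hy
    _ = (B + 2 * K) * ‖x - y‖ := by ring

variable [FiniteDimensional ℝ E] [Nontrivial E] [MeasurableSpace E] [BorelSpace E]
  (μ : Measure E) [μ.IsAddHaarMeasure]

instance : IsProbabilityMeasure μ.toSphere[|Set.univ] :=
  cond_isProbabilityMeasure_of_finite
    (Measure.measure_univ_ne_zero.2 μ.toSphere_ne_zero) (measure_ne_top _ _)

theorem lintegral_eq_lintegral_toSphere_volumeIoiPow {f : E → ℝ≥0∞} (hf : Measurable f) :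
    ∫⁻ x, f x ∂μ = ∫⁻ u, ∫⁻ r, f ((r : ℝ) • (u : E))
      ∂Measure.volumeIoiPow (Module.finrank ℝ E - 1) ∂μ.toSphere := by
  have hmeas : Measurable fun p : sphere (0 : E) 1 × Set.Ioi (0 : ℝ) ↦ f ((p.2 : ℝ) • (p.1 : E)) :=
    by fun_prop
  calc ∫⁻ x, f x ∂μ = ∫⁻ x : ({0}ᶜ : Set E), f x ∂μ.comap (↑) := by
        rw [lintegral_subtype_comap (measurableSet_singleton _).compl, restrict_compl_singleton]
    _ = ∫⁻ x : ({0}ᶜ : Set E), f ((homeomorphUnitSphereProd E x).2.1 •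
          (homeomorphUnitSphereProd E x).1.1) ∂μ.comap (↑) := by
        refine lintegral_congr fun x ↦ ?_
        have : ‖(x : E)‖ ≠ 0 := norm_ne_zero_iff.2 x.2
        simp [this]
    _ = ∫⁻ p, f ((p.2 : ℝ) • (p.1 : E))
          ∂μ.toSphere.prod (.volumeIoiPow (Module.finrank ℝ E - 1)) :=
        μ.measurePreserving_homeomorphUnitSphereProd.lintegral_comp hmeas
    _ = _ := lintegral_prod _ hmeas.aemeasurable

theorem lintegral_comp_norm_eq_toSphere_univ_mul {f : ℝ → ℝ≥0∞} (hf : Measurable f) :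
    ∫⁻ x, f ‖x‖ ∂μ = μ.toSphere Set.univ *
      ∫⁻ r, f (r : ℝ) ∂Measure.volumeIoiPow (Module.finrank ℝ E - 1) := by
  rw [lintegral_eq_lintegral_toSphere_volumeIoiPow μ (by fun_prop), mul_comm, ← lintegral_const]
  refine lintegral_congr fun u ↦ lintegral_congr fun r ↦ ?_
  rw [norm_smul, norm_eq_of_mem_sphere, mul_one, Real.norm_of_nonneg (Set.mem_Ioi.1 r.2).le]

theorem measurePreserving_norm_smul_of_radial_density {w : ℝ → ℝ≥0∞} (hw : Measurable w) :
    MeasurePreserving (fun p : E × sphere (0 : E) 1 ↦ ‖p.1‖ • (p.2 : E))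
      ((μ.withDensity fun x ↦ w ‖x‖).prod μ.toSphere[|Set.univ])
      (μ.withDensity fun x ↦ w ‖x‖) := by
  have hmeas : Measurable fun p : E × sphere (0 : E) 1 ↦ ‖p.1‖ • (p.2 : E) := by fun_prop
  refine ⟨hmeas, Measure.ext_of_lintegral _ fun f hf ↦ ?_⟩
  have hS₀ : μ.toSphere Set.univ ≠ 0 := Measure.measure_univ_ne_zero.2 μ.toSphere_ne_zero
  have radial (u : sphere (0 : E) 1) :
      ∫⁻ x, f (‖x‖ • (u : E)) ∂μ.withDensity (fun x ↦ w ‖x‖) = μ.toSphere Set.univ *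
        ∫⁻ r, w r * f ((r : ℝ) • (u : E)) ∂Measure.volumeIoiPow (Module.finrank ℝ E - 1) := by
    rw [lintegral_withDensity_eq_lintegral_mul _ (by fun_prop) (by fun_prop)]
    exact lintegral_comp_norm_eq_toSphere_univ_mul μ (f := fun r ↦ w r * f (r • (u : E)))
      (by fun_prop)
  calc ∫⁻ x, f x ∂Measure.map _ _
      = ∫⁻ u, ∫⁻ x, f (‖x‖ • (u : E)) ∂μ.withDensity (fun x ↦ w ‖x‖) ∂μ.toSphere[|Set.univ] := by
        rw [lintegral_map hf hmeas]
        exact lintegral_prod_symm _ (hf.comp hmeas).aemeasurable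
    _ = ∫⁻ u, ∫⁻ r, w r * f ((r : ℝ) • (u : E))
          ∂Measure.volumeIoiPow (Module.finrank ℝ E - 1) ∂μ.toSphere := by
        simp_rw [radial]
        rw [ProbabilityTheory.cond, Measure.restrict_univ, lintegral_smul_measure,
          lintegral_const_mul' _ _ (measure_ne_top _ _), smul_eq_mul, ← mul_assoc,
          ENNReal.inv_mul_cancel hS₀ (measure_ne_top _ _), one_mul]
    _ = ∫⁻ x, f x ∂μ.withDensity (fun x ↦ w ‖x‖) := by
        rw [lintegral_withDensity_eq_lintegral_mul _ (by fun_prop) hf,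
          lintegral_eq_lintegral_toSphere_volumeIoiPow μ (by fun_prop)]
        refine lintegral_congr fun u ↦ lintegral_congr fun r ↦ ?_
        rw [Pi.mul_apply, norm_smul, norm_eq_of_mem_sphere, mul_one,
          Real.norm_of_nonneg (Set.mem_Ioi.1 r.2).le]

end Normed

variable {E : Type*} [NormedAddCommGroup E] [InnerProductSpace ℝ E] [FiniteDimensional ℝ E]
  [Nontrivial E] [MeasurableSpace E] [BorelSpace E]

theorem measurePreserving_norm_smul_stdGaussian :
    MeasurePreserving (fun p : E × sphere (0 : E) 1 ↦ ‖p.1‖ • (p.2 : E))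
      ((stdGaussian E).prod (volume : Measure E).toSphere[|Set.univ]) (stdGaussian E) := by
  have hw : Measurable fun r : ℝ ↦ ENNReal.ofReal
    (((2 * π) ^ (Module.finrank ℝ E / 2 : ℝ))⁻¹ * rexp (-(1 / 2) * r ^ 2)) := by fun_prop
  have := measurePreserving_norm_smul_of_radial_density (volume : Measure E) hw
  rwa [← stdGaussian_eq_withDensity] at this

/-- In the polar decomposition `‖x‖ • u` of a Gaussian vector the norm and the direction are
independent, so averaging the concentration of `‖x‖ * F (x / ‖x‖)` over the norm leaves a statement
about the direction only. -/
theorem hasSubgaussianMGF_sphere_of_lipschitzOnWith_of_abs_le {F : E → ℝ} {K B : ℝ≥0}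
    (hF : LipschitzOnWith K F (sphere 0 1)) (hB : ∀ u ∈ sphere (0 : E) 1, |F u| ≤ B) :
    HasSubgaussianMGF (fun u : sphere (0 : E) 1 ↦ (∫ x : E, ‖x‖ ∂stdGaussian E) *
        (F u - ∫ v : sphere (0 : E) 1, F v ∂(volume : Measure E).toSphere[|Set.univ]))
      ((NNReal.pi / 2 * (B + 2 * K)) ^ 2) (volume : Measure E).toSphere[|Set.univ] := by
  have polar := measurePreserving_norm_smul_stdGaussian (E := E)
  have hG := lipschitzWith_norm_mul_comp_normalize hF hB
  have G_smul (x : E) (u : sphere (0 : E) 1) :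
      ‖‖x‖ • (u : E)‖ * F (‖‖x‖ • (u : E)‖⁻¹ • ‖x‖ • (u : E)) = ‖x‖ * F u := by
    rcases eq_or_ne x 0 with rfl | hx <;> simp [norm_smul, *]
  set m := ∫ x : E, ‖x‖ ∂stdGaussian E
  have integral_G : ∫ x, ‖x‖ * F (‖x‖⁻¹ • x) ∂stdGaussian E =
      m * ∫ v : sphere (0 : E) 1, F v ∂(volume : Measure E).toSphere[|Set.univ] := by
    rw [← integral_prod_mul, ← polar.map_eq,
      integral_map polar.aemeasurable hG.continuous.aestronglyMeasurable]
    simp_rw [G_smul, polar.map_eq]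
  have hsub := hasSubgaussianMGF_sub_integral_of_lipschitzWith hG
  rw [integral_G, ← polar.map_eq] at hsub
  refine (hasSubgaussianMGF_integral_left (hsub.of_map polar.aemeasurable)).congr
    (ae_of_all _ fun u ↦ ?_)
  simp only [Function.comp_apply, G_smul]
  rw [integral_sub _ (integrable_const _), integral_mul_const, mul_sub]
  · simp [m]
  · exact (integrable_stdGaussian_of_lipschitzWith lipschitzWith_one_norm).mul_const _

theorem hasSubgaussianMGF_sphere_of_lipschitzOnWith {F : E → ℝ} {K : ℝ≥0}
    (hF : LipschitzOnWith K F (sphere 0 1)) :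
    HasSubgaussianMGF (fun u : sphere (0 : E) 1 ↦ (∫ x : E, ‖x‖ ∂stdGaussian E) *
        (F u - ∫ v : sphere (0 : E) 1, F v ∂(volume : Measure E).toSphere[|Set.univ]))
      ((2 * NNReal.pi * K) ^ 2) (volume : Measure E).toSphere[|Set.univ] := by
  obtain ⟨u₀, hu₀⟩ := (NormedSpace.sphere_nonempty (x := (0 : E)) (r := 1)).2 zero_le_one
  have hF₀ : LipschitzOnWith K (fun x ↦ F x - F u₀) (sphere 0 1) := by
    simpa using hF.sub (LipschitzWith.const (F u₀)).lipschitzOnWith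
  have F₀_le (u : E) (hu : u ∈ sphere (0 : E) 1) : |F u - F u₀| ≤ (2 * K : ℝ≥0) := by
    refine (hF.dist_le_mul u hu u₀ hu₀).trans ?_
    rw [NNReal.coe_mul, mul_comm]
    gcongr
    calc dist u u₀ ≤ dist u 0 + dist u₀ 0 := dist_triangle_right _ _ _
      _ = 2 := by rw [mem_sphere.1 hu, mem_sphere.1 hu₀]; norm_num
  convert hasSubgaussianMGF_sphere_of_lipschitzOnWith_of_abs_le hF₀ F₀_le using 2 with u
  · rw [integral_sub _ (integrable_const _)]
    · simp
    · exact hF.to_restrict.continuous.integrable_of_hasCompactSupport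
        (HasCompactSupport.of_compactSpace _)
  · ring

end SphereConcentration

section LevyConcentration

open ProbabilityTheory hiding uniformOn
open Real
open scoped ProbabilityTheory

/-- The first absolute moment of a standard Gaussian real random variable, which bounds the mean
norm of a standard Gaussian vector from below. -/
noncomputable def gaussianAbsMoment : ℝ := ∫ x, |x| ∂(gaussianReal 0 1)

theorem integrable_abs_gaussianReal : Integrable (fun x : ℝ ↦ |x|) (gaussianReal 0 1) :=
  (IsGaussian.integrable_id (μ := gaussianReal 0 1)).norm

theorem gaussianAbsMoment_pos : 0 < gaussianAbsMoment := by
  have support_abs : Function.support (fun x : ℝ ↦ |x|) = {0}ᶜ := by ext; simp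
  have : NullSingletonClass (gaussianReal 0 1) := nullSingletonClass_gaussianReal one_ne_zero
  rw [gaussianAbsMoment,
    integral_pos_iff_support_of_nonneg (fun x ↦ abs_nonneg x) integrable_abs_gaussianReal,
    support_abs, prob_compl_eq_one_sub (measurableSet_singleton _), measure_singleton]
  simp

theorem measurePreserving_apply_stdGaussian {ι : Type*} [Fintype ι] (i : ι) :
    MeasurePreserving (fun x : EuclideanSpace ℝ ι ↦ x i)
      (stdGaussian (EuclideanSpace ℝ ι)) (gaussianReal 0 1) := by
  classical
  simpa using measurePreserving_eval_multivariateGaussian (μ := (0 : EuclideanSpace ℝ ι))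
    Matrix.PosSemidef.one (i := i)

theorem gaussianAbsMoment_mul_sqrt_card_le (ι : Type*) [Fintype ι] :
    gaussianAbsMoment * √(Fintype.card ι) ≤ ∫ x, ‖x‖ ∂stdGaussian (EuclideanSpace ℝ ι) := by
  rcases isEmpty_or_nonempty ι with hι | hι
  · simpa using integral_nonneg fun x : EuclideanSpace ℝ ι ↦ norm_nonneg x
  have hcard : 0 < √(Fintype.card ι : ℝ) := by simp [Fintype.card_pos]
  have sum_abs_le (x : EuclideanSpace ℝ ι) : ∑ i, |x i| ≤ √(Fintype.card ι) * ‖x‖ := by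
    rw [EuclideanSpace.norm_eq, ← Real.sqrt_mul (Nat.cast_nonneg _)]
    refine Real.le_sqrt_of_sq_le ?_
    simpa using sq_sum_le_card_mul_sum_sq (s := Finset.univ) (f := fun i ↦ |x i|)
  have integrable_abs (i : ι) :
      Integrable (fun x : EuclideanSpace ℝ ι ↦ |x i|) (stdGaussian _) :=
    (measurePreserving_apply_stdGaussian i).integrable_comp_of_integrable
      integrable_abs_gaussianReal
  have integral_abs (i : ι) :
      ∫ x : EuclideanSpace ℝ ι, |x i| ∂stdGaussian _ = gaussianAbsMoment := by
    rw [gaussianAbsMoment, ← (measurePreserving_apply_stdGaussian i).map_eq,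
      integral_map (measurePreserving_apply_stdGaussian i).aemeasurable (by fun_prop)]
  refine le_of_mul_le_mul_left ?_ hcard
  calc √(Fintype.card ι) * (gaussianAbsMoment * √(Fintype.card ι))
      = Fintype.card ι * gaussianAbsMoment := by
        rw [mul_left_comm, Real.mul_self_sqrt (Nat.cast_nonneg _), mul_comm]
    _ = ∫ x : EuclideanSpace ℝ ι, ∑ i, |x i| ∂stdGaussian _ := by
        simp [integral_finsetSum _ fun i _ ↦ integrable_abs i, integral_abs]
    _ ≤ ∫ x : EuclideanSpace ℝ ι, √(Fintype.card ι) * ‖x‖ ∂stdGaussian _ :=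
        integral_mono (integrable_finsetSum _ fun i _ ↦ integrable_abs i)
          ((integrable_stdGaussian_of_lipschitzWith lipschitzWith_one_norm).const_mul _) sum_abs_le
    _ = √(Fintype.card ι) * ∫ x, ‖x‖ ∂stdGaussian (EuclideanSpace ℝ ι) :=
        integral_const_mul _ _

theorem uniformOn_eq_of_measure_compl_eq_zero {M : ℕ} {Θ : Set (ParamSphere M)}
    (hΘ : surfaceMeasure M Θᶜ = 0) :
    uniformOn Θ = (volume : Measure (EuclideanSpace ℝ (Fin M))).toSphere[|Set.univ] := by
  have hae : Θ =ᵐ[surfaceMeasure M] Set.univ := ae_eq_univ.2 hΘ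
  rw [uniformOn, ProbabilityTheory.cond, measure_congr hae, Measure.restrict_congr_set hae]
  rfl

theorem exists_lipschitzWith_eqOn {E : Type*} [PseudoMetricSpace E] {s : Set E} {Θ : Set s}
    {f : s → ℝ} {K : ℝ≥0} (hf : LipschitzOnWith K f Θ) :
    ∃ F : E → ℝ, LipschitzWith K F ∧ Set.EqOn f (fun θ ↦ F θ) Θ := by
  have hf' : LipschitzOnWith K (Function.extend (↑) f 0 : E → ℝ) ((↑) '' Θ) := by
    rintro _ ⟨x, hx, rfl⟩ _ ⟨y, hy, rfl⟩
    simpa only [Subtype.val_injective.extend_apply, Subtype.edist_eq] using hf hx hy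
  obtain ⟨F, hF, hfF⟩ := hf'.extend_real
  refine ⟨F, hF, fun θ hθ ↦ ?_⟩
  exact (Subtype.val_injective.extend_apply f 0 θ).symm.trans (hfF (Set.mem_image_of_mem _ hθ))

theorem measureReal_le_abs_sphere_le_of_lipschitzOnWith {E : Type*} [NormedAddCommGroup E]
    [InnerProductSpace ℝ E] [FiniteDimensional ℝ E] [Nontrivial E] [MeasurableSpace E]
    [BorelSpace E] {F : E → ℝ} {K : ℝ≥0} (hF : LipschitzOnWith K F (Metric.sphere 0 1))
    {s : ℝ} (hs : 0 ≤ s) :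
    ((volume : Measure E).toSphere[|Set.univ]).real {u | s ≤
        |F u - ∫ v : Metric.sphere (0 : E) 1, F v ∂(volume : Measure E).toSphere[|Set.univ]|} ≤
      2 * rexp (-((∫ x : E, ‖x‖ ∂stdGaussian E) ^ 2 * s ^ 2 / (8 * π ^ 2 * K ^ 2))) := by
  set m := ∫ x : E, ‖x‖ ∂stdGaussian E
  have hm₀ : 0 ≤ m := integral_nonneg fun x ↦ norm_nonneg x
  have mul_le_abs_mul {y : ℝ} (hy : s ≤ |y|) : m * s ≤ |m * y| := by
    rw [abs_mul, abs_of_nonneg hm₀]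
    exact mul_le_mul_of_nonneg_left hy hm₀
  have tail := measureReal_le_abs_le_of_hasSubgaussianMGF
    (hasSubgaussianMGF_sphere_of_lipschitzOnWith hF) (mul_nonneg hm₀ hs)
  refine (measureReal_mono fun u hu ↦ mul_le_abs_mul hu).trans (tail.trans_eq ?_)
  push_cast [NNReal.coe_real_pi]
  ring_nf

theorem levyConcentration_of_measure_compl_eq_zero {M : ℕ} (hM : 1 ≤ M)
    {Θ : Set (ParamSphere M)} (hΘ : surfaceMeasure M Θᶜ = 0) :
    LevyConcentration (gaussianAbsMoment ^ 2 / (8 * π ^ 2)) Θ := by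
  intro f K hK hf s hs
  have : Nonempty (Fin M) := ⟨⟨0, hM⟩⟩
  obtain ⟨F, hF, hfF⟩ := exists_lipschitzWith_eqOn hf
  have hΘ_ae : ∀ᵐ θ ∂surfaceMeasure M, θ ∈ Θ := ae_iff.2 hΘ
  have f_ae_eq : f =ᵐ[uniformOn Θ] fun θ ↦ F θ :=
    cond_absolutelyContinuous.ae_le (hΘ_ae.mono hfF)
  have tail_congr : (uniformOn Θ).real {θ | s ≤ |f θ - ∫ θ', f θ' ∂uniformOn Θ|} =
      (uniformOn Θ).real {θ | s ≤ |F θ - ∫ θ' : ParamSphere M, F θ' ∂uniformOn Θ|} := by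
    rw [integral_congr_ae f_ae_eq]
    exact measureReal_congr <| f_ae_eq.mono fun θ hθ ↦ congrArg (fun y ↦ s ≤ |y - _|) hθ
  have hnorm := gaussianAbsMoment_mul_sqrt_card_le (Fin M)
  rw [Fintype.card_fin] at hnorm
  rw [tail_congr, uniformOn_eq_of_measure_compl_eq_zero hΘ]
  refine (measureReal_le_abs_sphere_le_of_lipschitzOnWith hF.lipschitzOnWith hs.le).trans ?_
  gcongr 2 * rexp (-?_)
  calc gaussianAbsMoment ^ 2 / (8 * π ^ 2) * M * s ^ 2 / K ^ 2
      = (gaussianAbsMoment * √M) ^ 2 * s ^ 2 / (8 * π ^ 2 * K ^ 2) := by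
        rw [mul_pow, Real.sq_sqrt (Nat.cast_nonneg M)]
        field_simp
    _ ≤ _ := by
        have := gaussianAbsMoment_pos
        gcongr

end LevyConcentration

section TraceNorm

open scoped MatrixOrder Matrix.Norms.L2Operator

theorem norm_le_one_of_mem_Icc_neg_one_one {A : Type*} [CStarAlgebra A] [PartialOrder A]
    [StarOrderedRing A] [NonnegSpectrumClass ℝ A] {a : A} (ha : a ∈ Set.Icc (-1) 1) : ‖a‖ ≤ 1 := by
  nontriviality A
  have hsa : IsSelfAdjoint a := by
    simpa using (IsSelfAdjoint.one A).sub (sub_nonneg.2 ha.2).isSelfAdjoint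
  have spectrum_le := (le_algebraMap_iff_spectrum_le (r := (1 : ℝ)) hsa).1 (by simpa using ha.2)
  have le_spectrum := (algebraMap_le_iff_le_spectrum (r := (-1 : ℝ)) hsa).1 (by simpa using ha.1)
  rcases CStarAlgebra.norm_or_neg_norm_mem_spectrum hsa with h | h
  · exact spectrum_le _ h
  · exact neg_le_neg_iff.1 (le_spectrum _ h)

variable {n : Type*} [Fintype n]

theorem trace_mul_nonneg_of_posSemidef {A B : Matrix n n ℂ} (hA : A.PosSemidef)
    (hB : B.PosSemidef) : 0 ≤ (A * B).trace := by
  classical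
  obtain ⟨C, rfl⟩ := CStarAlgebra.nonneg_iff_eq_star_mul_self.1 hA.nonneg
  rw [Matrix.star_eq_conjTranspose, Matrix.mul_assoc, Matrix.trace_mul_comm]
  exact (hB.mul_mul_conjTranspose_same C).trace_nonneg

open Matrix in
theorem posSemidef_of_forall_trace_mul_vecMulVec_nonneg {A : Matrix n n ℂ}
    (hA : ∀ x : n → ℂ, 0 ≤ (A * vecMulVec x (star x)).trace) : A.PosSemidef := by
  classical
  rw [← Matrix.isPositive_toEuclideanLin_iff, LinearMap.isPositive_iff_complex]
  intro x
  have hinner : inner ℂ (A.toEuclideanLin x) x = star (A * vecMulVec x (star x.ofLp)).trace := by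
    rw [Matrix.mul_vecMulVec, Matrix.trace_vecMulVec, EuclideanSpace.inner_eq_star_dotProduct,
      ← Matrix.star_dotProduct_star]
    simp [Matrix.toLpLin_apply]
  obtain ⟨r, hr, h⟩ := RCLike.nonneg_iff_exists_ofReal.1 (hA x)
  rw [hinner, ← h]
  simpa using hr

variable [DecidableEq n]

theorem trace_eq_sum_inner_toEuclideanLin {ι : Type*} [Fintype ι] (A : Matrix n n ℂ)
    (b : OrthonormalBasis ι ℂ (EuclideanSpace ℂ n)) :
    A.trace = ∑ i, inner ℂ (b i) (A.toEuclideanLin (b i)) := by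
  rw [← LinearMap.trace_eq_sum_inner _ b, Matrix.toEuclideanLin_eq_toLin_orthonormal,
    Matrix.trace_toLin_eq]

theorem norm_toEuclideanLin_eigenvectorBasis (Y : Matrix n n ℂ) (i : n) :
    ‖Y.toEuclideanLin ((Matrix.isHermitian_conjTranspose_mul_self Y).eigenvectorBasis i)‖ =
      √((Matrix.isHermitian_conjTranspose_mul_self Y).eigenvalues i) := by
  set hY := Matrix.isHermitian_conjTranspose_mul_self Y
  rw [hY.eigenvalues_eq, ← Matrix.mulVec_mulVec, Matrix.dotProduct_mulVec, ← Matrix.star_mulVec,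
    norm_eq_sqrt_re_inner (𝕜 := ℂ), EuclideanSpace.inner_eq_star_dotProduct, dotProduct_comm]
  rfl

theorem norm_trace_mul_le (W Y : Matrix n n ℂ) : ‖(W * Y).trace‖ ≤ ‖W‖ * traceNorm Y := by
  set b := (Matrix.isHermitian_conjTranspose_mul_self Y).eigenvectorBasis
  calc ‖(W * Y).trace‖
      = ‖∑ i, inner ℂ (b i) (W.toEuclideanLin (Y.toEuclideanLin (b i)))‖ := by
        rw [trace_eq_sum_inner_toEuclideanLin _ b, Matrix.toEuclideanLin, Matrix.toLpLin_mul_same]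
        rfl
    _ ≤ ∑ i, ‖W‖ * ‖Y.toEuclideanLin (b i)‖ := norm_sum_le_of_le _ fun i _ ↦ by
        refine (norm_inner_le_norm _ _).trans ?_
        rw [b.norm_eq_one, one_mul]
        exact W.l2_opNorm_mulVec _
    _ = ‖W‖ * traceNorm Y := by
        rw [traceNorm, Finset.mul_sum]
        simp_rw [b, norm_toEuclideanLin_eigenvectorBasis]

theorem ofReal_traceNorm (A : Matrix n n ℂ) : (traceNorm A : ℂ) = (CFC.abs A).trace := by
  have hA := Matrix.isHermitian_conjTranspose_mul_self A
  rw [CFC.abs, CFC.sqrt_eq_real_sqrt _ (star_mul_self_nonneg A), cfcₙ_eq_cfc,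
    Matrix.star_eq_conjTranspose, hA.cfc_eq, Matrix.IsHermitian.cfc]
  simp [traceNorm, Matrix.trace_mul_cycle]

theorem ofReal_traceNorm_of_posSemidef {A : Matrix n n ℂ} (hA : A.PosSemidef) :
    (traceNorm A : ℂ) = A.trace := by
  rw [ofReal_traceNorm, CFC.abs_of_nonneg A hA.nonneg]

end TraceNorm

section Duhamel

theorem hasDerivAt_exp_mul_exp {𝔸 : Type*} [NormedRing 𝔸] [NormedAlgebra ℝ 𝔸] [CompleteSpace 𝔸]
    (a b : 𝔸) (t s : ℝ) :
    HasDerivAt (fun s : ℝ ↦ NormedSpace.exp ((t - s) • a) * NormedSpace.exp (s • b))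
      (NormedSpace.exp ((t - s) • a) * ((b - a) * NormedSpace.exp (s • b))) s := by
  have h := ((hasDerivAt_exp_smul_const (𝕂 := ℝ) a (t - s)).scomp s
    ((hasDerivAt_id s).const_sub t)).mul (hasDerivAt_exp_smul_const' (𝕂 := ℝ) b s)
  refine h.congr_deriv ?_
  simp only [Function.comp_apply, neg_one_smul]
  noncomm_ring

variable {n : Type*} [Fintype n] [DecidableEq n]

/-- The functional `A ↦ Tr(Φ A(ρ))` on superoperators, given by their matrices in the basis of
matrix units. -/
noncomputable def expectationFunctional (Φ ρ : Matrix n n ℂ) :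
    Matrix (n × n) (n × n) ℂ →ₗ[ℂ] ℂ :=
  Matrix.traceLinearMap n ℂ ℂ ∘ₗ LinearMap.mulLeft ℂ Φ ∘ₗ LinearMap.applyₗ ρ ∘ₗ
    (LinearMap.toMatrixAlgEquiv (Matrix.stdBasis ℂ n n)).symm.toLinearMap

theorem expectationFunctional_toMatrixAlgEquiv (Φ ρ : Matrix n n ℂ) (T : SuperOp n) :
    expectationFunctional Φ ρ (LinearMap.toMatrixAlgEquiv (Matrix.stdBasis ℂ n n) T) =
      (Φ * T ρ).trace := by
  simp [expectationFunctional]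

theorem toMatrixAlgEquiv_semigroup (L : SuperOp n) (t : ℝ) :
    LinearMap.toMatrixAlgEquiv (Matrix.stdBasis ℂ n n) (semigroup L t) =
      NormedSpace.exp (t • LinearMap.toMatrixAlgEquiv (Matrix.stdBasis ℂ n n) L) := by
  rw [semigroup, AlgEquiv.apply_symm_apply, Complex.coe_smul]

theorem semigroup_zero (L : SuperOp n) : semigroup L 0 = 1 := by
  simp [semigroup]

open scoped Matrix.Norms.L2Operator in
theorem hasDerivAt_trace_mul_semigroup_semigroup (L L' : SuperOp n) (Φ ρ : Matrix n n ℂ)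
    (t s : ℝ) :
    HasDerivAt (fun s : ℝ ↦ (Φ * semigroup L (t - s) (semigroup L' s ρ)).trace)
      (Φ * semigroup L (t - s) ((L' - L) (semigroup L' s ρ))).trace s := by
  have h := ((expectationFunctional Φ ρ).toContinuousLinearMap.restrictScalars ℝ).hasFDerivAt
    |>.comp_hasDerivAt s (hasDerivAt_exp_mul_exp
      (LinearMap.toMatrixAlgEquiv (Matrix.stdBasis ℂ n n) L)
      (LinearMap.toMatrixAlgEquiv (Matrix.stdBasis ℂ n n) L') t s)
  simp only [← toMatrixAlgEquiv_semigroup, ← map_mul, ← map_sub] at h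
  simpa only [Function.comp_def, ContinuousLinearMap.coe_restrictScalars',
    LinearMap.coe_toContinuousLinearMap', expectationFunctional_toMatrixAlgEquiv,
    Module.End.mul_apply] using h

open scoped Matrix.Norms.L2Operator in
theorem continuous_trace_mul_semigroup_apply {Z : Type*} [TopologicalSpace Z] {L : Z → SuperOp n}
    (hL : Continuous fun z ↦ LinearMap.toMatrixAlgEquiv (Matrix.stdBasis ℂ n n) (L z))
    (Φ ρ : Matrix n n ℂ) (t : ℝ) :
    Continuous fun z ↦ (Φ * semigroup (L z) t ρ).trace := by
  let : NormedAlgebra ℚ (Matrix (n × n) (n × n) ℂ) := NormedAlgebra.restrictScalars ℚ ℝ _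
  simp only [← expectationFunctional_toMatrixAlgEquiv, toMatrixAlgEquiv_semigroup]
  exact (expectationFunctional Φ ρ).continuous_of_finiteDimensional.comp
    (NormedSpace.exp_continuous.comp (hL.const_smul t))

end Duhamel

section Lindbladian

open scoped MatrixOrder Matrix.Norms.L2Operator

/-- Density matrices. -/
structure IsState {n : Type*} [Fintype n] (σ : Matrix n n ℂ) : Prop where
  posSemidef : σ.PosSemidef
  trace_eq_one : σ.trace = 1

theorem exists_forall_trace_mul_eq {R n : Type*} [CommRing R] [Fintype n]
    (f : Matrix n n R →ₗ[R] R) : ∃ W : Matrix n n R, ∀ Y, (W * Y).trace = f Y := by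
  classical
  let W : Matrix n n R := Matrix.of fun i j ↦ f (Matrix.single j i 1)
  have hW : Matrix.traceLinearMap n R R ∘ₗ LinearMap.mulLeft R W = f := by
    refine Matrix.ext_linearMap R fun i j ↦ LinearMap.ext_ring ?_
    simp [W, Matrix.trace_mul_single]
  exact ⟨W, fun Y ↦ LinearMap.congr_fun hW Y⟩

variable {n : Type*} [Fintype n]

theorem IsCPTP.posSemidef_apply {T : SuperOp n} (hT : IsCPTP T) {Y : Matrix n n ℂ}
    (hY : Y.PosSemidef) : (T Y).PosSemidef :=
  (hT.completelyPositive 1 (Y.submatrix Prod.fst Prod.fst)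
    (hY.submatrix Prod.fst)).submatrix fun i : n ↦ (i, (0 : Fin 1))

theorem IsCPTP.isState_apply {T : SuperOp n} (hT : IsCPTP T) {σ : Matrix n n ℂ}
    (hσ : IsState σ) : IsState (T σ) :=
  ⟨hT.posSemidef_apply hσ.posSemidef, (hT.tracePreserving σ).trans hσ.trace_eq_one⟩

theorem IsCPTP.posSemidef_dual {T : SuperOp n} (hT : IsCPTP T) {Φ W : Matrix n n ℂ}
    (hΦ : Φ.PosSemidef) (hW : ∀ Y, (W * Y).trace = (Φ * T Y).trace) : W.PosSemidef :=
  posSemidef_of_forall_trace_mul_vecMulVec_nonneg fun x ↦ by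
    rw [hW]
    exact trace_mul_nonneg_of_posSemidef hΦ
      (hT.posSemidef_apply (Matrix.posSemidef_vecMulVec_self_star x))

variable [DecidableEq n]

theorem IsCPTP.exists_dual_mem_Icc {T : SuperOp n} (hT : IsCPTP T) {Φ : Matrix n n ℂ}
    (hΦ : Φ ∈ Set.Icc (-1) 1) :
    ∃ W ∈ Set.Icc (-1 : Matrix n n ℂ) 1, ∀ Y, (W * Y).trace = (Φ * T Y).trace := by
  obtain ⟨W, hW : ∀ Y, (W * Y).trace = (Φ * T Y).trace⟩ := exists_forall_trace_mul_eq
    (Matrix.traceLinearMap n ℂ ℂ ∘ₗ LinearMap.mulLeft ℂ Φ ∘ₗ T)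
  refine ⟨W, ⟨Matrix.le_iff.2 (hT.posSemidef_dual (Matrix.le_iff.1 hΦ.1) fun Y ↦ ?_),
    Matrix.le_iff.2 (hT.posSemidef_dual (Matrix.le_iff.1 hΦ.2) fun Y ↦ ?_)⟩, hW⟩ <;>
  simp [Matrix.sub_mul, Matrix.add_mul, hW, hT.tracePreserving]

theorem norm_trace_mul_semigroup_sub_le {L L' : SuperOp n} (hL : IsLindbladian L)
    (hL' : IsLindbladian L') {Φ ρ : Matrix n n ℂ} (hΦ : Φ ∈ Set.Icc (-1) 1) (hρ : IsState ρ)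
    {B t : ℝ} (ht : 0 ≤ t)
    (hB : ∀ W ∈ Set.Icc (-1 : Matrix n n ℂ) 1, ∀ σ, IsState σ →
      ‖(W * (L' - L) σ).trace‖ ≤ B) :
    ‖(Φ * semigroup L' t ρ).trace - (Φ * semigroup L t ρ).trace‖ ≤ B * t := by
  have h := norm_image_sub_le_of_norm_deriv_le_segment' (a := 0) (b := t) (C := B)
    (fun s _ ↦ (hasDerivAt_trace_mul_semigroup_semigroup L L' Φ ρ t s).hasDerivWithinAt)
    (fun s hs ↦ ?_) t (Set.right_mem_Icc.2 ht)
  · simpa [semigroup_zero] using h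
  · obtain ⟨W, hW_mem, hW⟩ := (hL (t - s) (sub_nonneg.2 hs.2.le)).exists_dual_mem_Icc hΦ
    rw [← hW]
    exact hB W hW_mem _ ((hL' s hs.1).isState_apply hρ)

theorem IsState.traceNorm_eq_one {σ : Matrix n n ℂ} (hσ : IsState σ) : traceNorm σ = 1 := by
  exact_mod_cast (ofReal_traceNorm_of_posSemidef hσ.posSemidef).trans hσ.trace_eq_one

theorem traceNorm_apply_le_of_oneToOneNorm_le {T : SuperOp n} {C : ℝ} (hC : 0 ≤ C)
    (hT : oneToOneNorm T ≤ ENNReal.ofReal C) {σ : Matrix n n ℂ} (hσ : IsState σ) :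
    traceNorm (T σ) ≤ C := by
  have hσ_ne : σ ≠ 0 := by
    rintro rfl
    simpa using hσ.trace_eq_one
  have h : ENNReal.ofReal (traceNorm (T σ) / traceNorm σ) ≤ ENNReal.ofReal C :=
    (le_iSup₂_of_le σ hσ_ne le_rfl).trans hT
  rwa [hσ.traceNorm_eq_one, div_one, ENNReal.ofReal_le_ofReal_iff hC] at h

theorem norm_trace_mul_apply_le {T : SuperOp n} {C : ℝ} (hC : 0 ≤ C)
    (hT : oneToOneNorm T ≤ ENNReal.ofReal C) {W σ : Matrix n n ℂ} (hW : W ∈ Set.Icc (-1) 1)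
    (hσ : IsState σ) : ‖(W * T σ).trace‖ ≤ C :=
  calc ‖(W * T σ).trace‖ ≤ ‖W‖ * traceNorm (T σ) := norm_trace_mul_le W (T σ)
    _ ≤ 1 * C := by
        gcongr
        · exact Finset.sum_nonneg fun _ _ ↦ Real.sqrt_nonneg _
        · exact norm_le_one_of_mem_Icc_neg_one_one hW
        · exact traceNorm_apply_le_of_oneToOneNorm_le hC hT hσ
    _ = C := one_mul C

end Lindbladian

namespace LindbladianEnsemble

open scoped MatrixOrder

variable {n X : Type*} [Fintype n] [DecidableEq n] [Fintype X] {M : ℕ} {δ C_G : ℝ}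
  (E : LindbladianEnsemble n X M δ C_G)

theorem isState_ρ : IsState E.ρ := ⟨E.posSemidef_ρ, E.trace_ρ⟩

theorem L_sub_L_apply (θ θ' : ParamSphere M) (σ : Matrix n n ℂ) :
    (E.L θ' - E.L θ) σ = ((δ / √M : ℝ) : ℂ) • ∑ j, ((θ'.1 j - θ.1 j : ℝ) : ℂ) • E.G j σ := by
  simp [L, sub_smul, smul_sub]

theorem norm_trace_mul_L_sub_L_le (hδ : 0 ≤ δ) (hC : 0 ≤ C_G) (θ θ' : ParamSphere M)
    {W σ : Matrix n n ℂ} (hW : W ∈ Set.Icc (-1) 1) (hσ : IsState σ) :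
    ‖(W * (E.L θ' - E.L θ) σ).trace‖ ≤ δ * C_G * dist θ' θ := by
  have sum_abs_le : ∑ j, |θ'.1 j - θ.1 j| ≤ √M * dist θ' θ := by
    rw [Subtype.dist_eq, EuclideanSpace.dist_eq, ← Real.sqrt_mul (Nat.cast_nonneg M)]
    apply Real.le_sqrt_of_sq_le
    simpa [Real.dist_eq] using
      sq_sum_le_card_mul_sum_sq (s := Finset.univ) (f := fun j ↦ |θ'.1 j - θ.1 j|)
  calc ‖(W * (E.L θ' - E.L θ) σ).trace‖
      = δ / √M * ‖∑ j, ((θ'.1 j - θ.1 j : ℝ) : ℂ) * (W * E.G j σ).trace‖ := by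
        rw [L_sub_L_apply, Matrix.mul_smul, Matrix.trace_smul, norm_smul, Complex.norm_real,
          Real.norm_of_nonneg (by positivity), Matrix.mul_sum, Matrix.trace_sum]
        simp_rw [Matrix.mul_smul, Matrix.trace_smul, smul_eq_mul]
    _ ≤ δ / √M * ∑ j, |θ'.1 j - θ.1 j| * C_G := by
        gcongr
        refine norm_sum_le_of_le _ fun j _ ↦ ?_
        rw [norm_mul, Complex.norm_real, Real.norm_eq_abs]
        gcongr
        exact norm_trace_mul_apply_le hC (E.norm_G_le j) hW hσ
    _ ≤ δ / √M * (√M * dist θ' θ * C_G) := by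
        rw [← Finset.sum_mul]
        gcongr
    _ = δ / √M * √M * (C_G * dist θ' θ) := by ring
    _ ≤ δ * (C_G * dist θ' θ) := by
        gcongr
        exact mul_le_of_le_div₀ hδ (Real.sqrt_nonneg _) le_rfl
    _ = δ * C_G * dist θ' θ := by ring

/-- The observable `∑ φ(x) M_x` whose expectation value is the value of the query `φ`. -/
noncomputable def observable (φ : Query X) : Matrix n n ℂ :=
  ∑ x, (φ.1 x : ℂ) • E.povm x

theorem observable_mem_Icc (φ : Query X) : E.observable φ ∈ Set.Icc (-1) 1 := by
  have one_sub : 1 - E.observable φ = ∑ x, ((1 - φ.1 x : ℝ) : ℂ) • E.povm x := by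
    simp [observable, sub_smul, E.sum_povm]
  have sub_neg_one : E.observable φ - -1 = ∑ x, ((φ.1 x - -1 : ℝ) : ℂ) • E.povm x := by
    simp [observable, add_smul, Finset.sum_add_distrib, E.sum_povm]
  rw [Set.mem_Icc, Matrix.le_iff, Matrix.le_iff, one_sub, sub_neg_one]
  constructor <;> refine Matrix.posSemidef_sum _ fun x _ ↦ (E.posSemidef_povm x).smul ?_
  · exact_mod_cast sub_nonneg.2 (φ.2 x).1
  · exact_mod_cast sub_nonneg.2 (φ.2 x).2

theorem expect_outDist (t : ℝ) (θ : ParamSphere M) (φ : Query X) :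
    expect (E.outDist t θ) φ = (E.observable φ * semigroup (E.L θ) t E.ρ).trace.re := by
  simp [expect, outDist, observable, Finset.sum_mul, Matrix.trace_sum]

theorem abs_expect_outDist_sub_le (hδ : 0 ≤ δ) (hC : 0 ≤ C_G) {t : ℝ} (ht : 0 ≤ t)
    {θ θ' : ParamSphere M} (hθ : θ ∈ E.Θ) (hθ' : θ' ∈ E.Θ) (φ : Query X) :
    |expect (E.outDist t θ') φ - expect (E.outDist t θ) φ| ≤ t * δ * C_G * dist θ' θ := by
  rw [expect_outDist, expect_outDist, ← Complex.sub_re]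
  calc |((E.observable φ * semigroup (E.L θ') t E.ρ).trace -
          (E.observable φ * semigroup (E.L θ) t E.ρ).trace).re|
      ≤ ‖(E.observable φ * semigroup (E.L θ') t E.ρ).trace -
          (E.observable φ * semigroup (E.L θ) t E.ρ).trace‖ := Complex.abs_re_le_norm _
    _ ≤ δ * C_G * dist θ' θ * t :=
        norm_trace_mul_semigroup_sub_le (E.lindbladian_of_mem θ hθ) (E.lindbladian_of_mem θ' hθ')
          (E.observable_mem_Icc φ) E.isState_ρ ht
          fun _ hW _ hσ ↦ E.norm_trace_mul_L_sub_L_le hδ hC θ θ' hW hσ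
    _ = t * δ * C_G * dist θ' θ := by ring

theorem continuous_outDist (t : ℝ) (x : X) : Continuous fun θ ↦ E.outDist t θ x := by
  refine Complex.continuous_re.comp (continuous_trace_mul_semigroup_apply ?_ (E.povm x) E.ρ t)
  simp only [L, map_add, map_smul, map_sum]
  fun_prop

end LindbladianEnsemble

section TotalVariation

variable {X : Type*} [Fintype X]

theorem tvDist_comm (P Q : X → ℝ) : tvDist P Q = tvDist Q P := by
  simp only [tvDist, abs_sub_comm]

theorem tvDist_triangle (P Q R : X → ℝ) : tvDist P R ≤ tvDist P Q + tvDist Q R := by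
  rw [tvDist, tvDist, tvDist, ← mul_add, ← Finset.sum_add_distrib]
  gcongr
  exact abs_sub_le _ _ _

theorem expect_sub_expect (P Q : X → ℝ) (φ : Query X) :
    expect P φ - expect Q φ = ∑ x, φ.1 x * (P x - Q x) := by
  simp only [expect, mul_sub, Finset.sum_sub_distrib]

theorem exists_query_expect_sub_eq (P Q : X → ℝ) :
    ∃ φ : Query X, expect P φ - expect Q φ = 2 * tvDist P Q := by
  refine ⟨⟨fun x ↦ SignType.sign (P x - Q x), fun x ↦ ?_⟩, ?_⟩
  · cases h : SignType.sign (P x - Q x) <;> simp [h]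
  · simp [expect_sub_expect, tvDist]

theorem abs_expect_sub_le (P Q : X → ℝ) (φ : Query X) :
    |expect P φ - expect Q φ| ≤ 2 * tvDist P Q := by
  calc |expect P φ - expect Q φ| ≤ ∑ x, |P x - Q x| := by
        rw [expect_sub_expect]
        refine Finset.abs_sum_le_sum_abs _ _ |>.trans (Finset.sum_le_sum fun x _ ↦ ?_)
        rw [abs_mul]
        exact mul_le_of_le_one_left (abs_nonneg _) (abs_le.2 (φ.2 x))
    _ = 2 * tvDist P Q := by simp [tvDist]

variable {γ : Type*} [MeasurableSpace γ] {P Q : γ → X → ℝ}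

theorem measurable_tvDist (hP : Measurable P) (hQ : Measurable Q) :
    Measurable fun c ↦ tvDist (P c) (Q c) := by
  unfold tvDist
  fun_prop

theorem measurable_expect {φ : γ → Query X} (hP : Measurable P) (hφ : Measurable φ) :
    Measurable fun c ↦ expect (P c) (φ c) := by
  have hφ_val : Measurable fun c ↦ (φ c).1 := measurable_subtype_coe.comp hφ
  exact Finset.measurable_sum _ fun x _ ↦
    (measurable_pi_iff.1 hφ_val x).mul (measurable_pi_iff.1 hP x)

end TotalVariation

section StatisticalQueries

variable {X : Type*} [Fintype X]

/-- Running `A` on the exact answers `Q[φ]` for at most `q` further queries, starting after the `k`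
answers `h`, either some query separates `P` from `Q` by more than `τ`, or `A` outputs a hypothesis
`ε`-close to `P`. The queries made do not depend on `P`, which is what allows a union bound over
them. -/
def SQAlgorithm.Detects (A : SQAlgorithm X) (Q : X → ℝ) (τ ε : ℝ) (P : X → ℝ) :
    (q k : ℕ) → (Fin k → ℝ) → Prop
  | 0, k, h => Sum.elim (fun _ ↦ False) (fun R ↦ tvDist R.1 P < ε) (A k h)
  | q + 1, k, h => Sum.elim
      (fun φ ↦ τ < |expect P φ - expect Q φ| ∨
        SQAlgorithm.Detects A Q τ ε P q (k + 1) (Fin.snoc h (expect Q φ)))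
      (fun R ↦ tvDist R.1 P < ε) (A k h)

open Classical in
/-- The oracle for `P` that answers as if the distribution were `Q` whenever this is admissible at
tolerance `τ`. It reveals nothing about `P` until a query separates `P` from `Q`. -/
noncomputable def maskedOracle (τ : ℝ) (Q P : X → ℝ) (φ : Query X) : ℝ :=
  if |expect P φ - expect Q φ| ≤ τ then expect Q φ else expect P φ

theorem isStatOracle_maskedOracle {τ : ℝ} (hτ : 0 ≤ τ) (Q P : X → ℝ) :
    IsStatOracle τ P (maskedOracle τ Q P) := by
  intro φ
  rw [maskedOracle]
  split_ifs with h
  · rwa [abs_sub_comm]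
  · simpa using hτ

theorem measurable_maskedOracle (τ : ℝ) (Q P : X → ℝ) : Measurable (maskedOracle τ Q P) := by
  have hP : Measurable (expect P) := measurable_expect measurable_const measurable_id
  have hQ : Measurable (expect Q) := measurable_expect measurable_const measurable_id
  exact Measurable.ite (measurableSet_le (hP.sub hQ).abs measurable_const) hQ hP

theorem SQAlgorithm.detects_of_run_maskedOracle (A : SQAlgorithm X) (Q : X → ℝ) {τ ε : ℝ}
    (P : X → ℝ) {R : stdSimplex ℝ X} (hR : tvDist R.1 P < ε) (q k : ℕ) (h : Fin k → ℝ)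
    (hrun : A.run (maskedOracle τ Q P) q k h = some R) : A.Detects Q τ ε P q k h := by
  induction q generalizing k with
  | zero =>
    rw [SQAlgorithm.run] at hrun
    rw [SQAlgorithm.Detects]
    cases hA : A k h <;> simp_all
  | succ q ih =>
    rw [SQAlgorithm.run] at hrun
    rw [SQAlgorithm.Detects]
    cases hA : A k h with
    | inl φ =>
      refine or_iff_not_imp_left.2 fun hφ ↦ ih (k + 1) _ ?_
      simpa [hA, maskedOracle, not_lt.1 hφ] using hrun
    | inr S => simp_all

theorem SQAlgorithm.Succeeds.detects {A : SQAlgorithm X} {Q P : X → ℝ} {τ ε : ℝ} {q : ℕ}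
    (h : A.Succeeds (maskedOracle τ Q P) ε q P) : A.Detects Q τ ε P q 0 Fin.elim0 := by
  obtain ⟨R, hrun, hR⟩ := h
  exact A.detects_of_run_maskedOracle Q P hR q 0 _ hrun

section Measurability

variable {α β γ Ω T : Type*} [MeasurableSpace α] [MeasurableSpace β] [MeasurableSpace γ]
  [MeasurableSpace Ω] [MeasurableSpace T]

theorem measurable_snoc {k : ℕ} {h : γ → Fin k → α} {y : γ → α} (hh : Measurable h)
    (hy : Measurable y) : Measurable fun c ↦ (Fin.snoc (h c) (y c) : Fin (k + 1) → α) := by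
  refine measurable_pi_iff.2 (Fin.lastCases ?_ fun j ↦ ?_)
  · simpa only [Fin.snoc_last] using hy
  · simpa only [Fin.snoc_castSucc] using measurable_pi_iff.1 hh j

theorem measurableSet_sumElim {a : γ → α ⊕ β} (ha : Measurable a) {p : α → γ → Prop}
    {r : β → γ → Prop} (hp : MeasurableSet {z : α × γ | p z.1 z.2})
    (hr : MeasurableSet {z : β × γ | r z.1 z.2}) :
    MeasurableSet {c : γ | Sum.elim (fun x ↦ p x c) (fun y ↦ r y c) (a c)} := by
  have hpr : MeasurableSet {s : (α × γ) ⊕ (β × γ) |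
      Sum.elim (fun z ↦ p z.1 z.2) (fun z ↦ r z.1 z.2) s} :=
    measurableSet_sum_iff.2 ⟨hp, hr⟩
  have hm : Measurable fun c ↦ MeasurableEquiv.sumProdDistrib α β γ (a c, c) :=
    (MeasurableEquiv.sumProdDistrib α β γ).measurable.comp (ha.prodMk measurable_id)
  convert hm hpr using 1
  ext c
  simp only [Set.mem_ofPred_eq, Set.mem_preimage]
  cases a c <;> rfl

theorem RandomizedSQAlgorithm.measurableSet_detects (A : RandomizedSQAlgorithm Ω X)
    {P : T → X → ℝ} (hP : Measurable P) (Q : X → ℝ) (τ ε : ℝ) (q k : ℕ) :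
    MeasurableSet {z : (Ω × (Fin k → ℝ)) × T |
      (A.alg z.1.1).Detects Q τ ε (P z.2) q k z.1.2} := by
  have halg (k) : Measurable fun z : (Ω × (Fin k → ℝ)) × T ↦ A.alg z.1.1 k z.1.2 :=
    (A.measurable_alg k).comp measurable_fst
  have hball (k) : MeasurableSet {z : stdSimplex ℝ X × ((Ω × (Fin k → ℝ)) × T) |
      tvDist z.1.1 (P z.2.2) < ε} :=
    measurableSet_lt (measurable_tvDist (by fun_prop) (by fun_prop)) measurable_const
  induction q generalizing k with
  | zero =>
    exact measurableSet_sumElim (p := fun _ _ ↦ False) (r := fun R z ↦ tvDist R.1 (P z.2) < ε)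
      (halg k) (by simp) (hball k)
  | succ q ih =>
    have hexpect : Measurable fun z : Query X × ((Ω × (Fin k → ℝ)) × T) ↦ expect Q z.1 :=
      measurable_expect measurable_const measurable_fst
    have hquery : MeasurableSet {z : Query X × ((Ω × (Fin k → ℝ)) × T) |
        τ < |expect (P z.2.2) z.1 - expect Q z.1|} :=
      measurableSet_lt measurable_const
        ((measurable_expect (by fun_prop) measurable_fst).sub hexpect).abs
    have hanswer : Measurable fun z : Query X × ((Ω × (Fin k → ℝ)) × T) ↦
        ((z.2.1.1, (Fin.snoc z.2.1.2 (expect Q z.1) : Fin (k + 1) → ℝ)), z.2.2) :=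
      ((by fun_prop : Measurable _).prodMk (measurable_snoc (by fun_prop) hexpect)).prodMk
        (by fun_prop)
    exact measurableSet_sumElim
      (p := fun φ z ↦ τ < |expect (P z.2) φ - expect Q φ| ∨ (A.alg z.1.1).Detects Q τ ε (P z.2)
        q (k + 1) (Fin.snoc z.1.2 (expect Q φ)))
      (r := fun R z ↦ tvDist R.1 (P z.2) < ε)
      (halg k) (hquery.union (measurableSet_preimage hanswer (ih (k + 1)))) (hball k)

end Measurability

section Measure

variable {T : Type*} [MeasurableSpace T] {μ : Measure T} {P : T → X → ℝ}
  {Q : X → ℝ} {τ ε η : ℝ}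

theorem SQAlgorithm.measureReal_detects_le (A : SQAlgorithm X) (hη : 0 ≤ η)
    (hquery : ∀ φ : Query X, μ.real {θ | τ < |expect (P θ) φ - expect Q φ|} ≤ η)
    (hball : ∀ R : stdSimplex ℝ X, μ.real {θ | tvDist R.1 (P θ) < ε} ≤ η)
    (q k : ℕ) (h : Fin k → ℝ) :
    μ.real {θ | A.Detects Q τ ε (P θ) q k h} ≤ (q + 1) * η := by
  induction q generalizing k with
  | zero =>
    simp only [SQAlgorithm.Detects]
    cases A k h with
    | inl φ => simpa using hη
    | inr R => simpa using hball R
  | succ q ih =>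
    simp only [SQAlgorithm.Detects, Nat.cast_succ]
    cases A k h with
    | inl φ =>
      calc μ.real ({θ | τ < |expect (P θ) φ - expect Q φ|} ∪
            {θ | A.Detects Q τ ε (P θ) q (k + 1) (Fin.snoc h (expect Q φ))})
          ≤ η + (q + 1) * η := (measureReal_union_le _ _).trans (add_le_add (hquery φ) (ih _ _))
        _ = (q + 1 + 1) * η := by ring
    | inr R =>
      exact (hball R).trans
        (le_mul_of_one_le_left hη (le_add_of_nonneg_left (by positivity)))

theorem SQAlgorithm.measureReal_learns_le [IsFiniteMeasure μ] (A : SQAlgorithm X) (hη : 0 ≤ η)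
    (hτ : 0 ≤ τ)
    (hquery : ∀ φ : Query X, μ.real {θ | τ < |expect (P θ) φ - expect Q φ|} ≤ η)
    (hball : ∀ R : stdSimplex ℝ X, μ.real {θ | tvDist R.1 (P θ) < ε} ≤ η) (q : ℕ) :
    μ.real {θ | A.Learns ε τ q (P θ)} ≤ (q + 1) * η :=
  (measureReal_mono fun θ hθ ↦ (hθ _ (isStatOracle_maskedOracle hτ Q (P θ))).detects).trans
    (A.measureReal_detects_le hη hquery hball q 0 Fin.elim0)

theorem mul_measureReal_le_of_le_measureReal_section [IsFiniteMeasure μ] {Ω : Type*}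
    [MeasurableSpace Ω] {ℙ : Measure Ω} [IsProbabilityMeasure ℙ] {H : Set (T × Ω)}
    (hH : MeasurableSet H) {α b : ℝ} (hα : 0 ≤ α) (hb : 0 ≤ b) {S : Set T}
    (hS : ∀ θ ∈ S, α ≤ ℙ.real {ω | (θ, ω) ∈ H})
    (hsection : ∀ ω, μ.real {θ | (θ, ω) ∈ H} ≤ b) : α * μ.real S ≤ b := by
  have hint : ∫⁻ θ, ℙ {ω | (θ, ω) ∈ H} ∂μ ≤ ENNReal.ofReal b :=
    calc ∫⁻ θ, ℙ {ω | (θ, ω) ∈ H} ∂μ = ∫⁻ ω, μ {θ | (θ, ω) ∈ H} ∂ℙ :=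
          (Measure.prod_apply hH).symm.trans (Measure.prod_apply_symm hH)
      _ ≤ ∫⁻ _, ENNReal.ofReal b ∂ℙ := lintegral_mono fun ω ↦ by
          rw [← ofReal_measureReal]
          exact ENNReal.ofReal_le_ofReal (hsection ω)
      _ = ENNReal.ofReal b := by simp
  have hmarkov : ENNReal.ofReal α * μ S ≤ ENNReal.ofReal b :=
    calc ENNReal.ofReal α * μ S
        ≤ ENNReal.ofReal α * μ {θ | ENNReal.ofReal α ≤ ℙ {ω | (θ, ω) ∈ H}} := by
          gcongr
          exact fun θ hθ ↦ ENNReal.ofReal_le_of_le_toReal (hS θ hθ)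
      _ ≤ ∫⁻ θ, ℙ {ω | (θ, ω) ∈ H} ∂μ :=
          mul_meas_ge_le_lintegral (measurable_measure_prodMk_left hH) _
      _ ≤ ENNReal.ofReal b := hint
  rwa [← ofReal_measureReal, ← ENNReal.ofReal_mul hα, ENNReal.ofReal_le_ofReal_iff hb] at hmarkov

theorem RandomizedSQAlgorithm.mul_measureReal_learns_le [IsFiniteMeasure μ] {Ω : Type*}
    [MeasurableSpace Ω] {ℙ : Measure Ω} [IsProbabilityMeasure ℙ] (A : RandomizedSQAlgorithm Ω X)
    (hP : Measurable P) (hη : 0 ≤ η) (hτ : 0 ≤ τ) {α : ℝ} (hα : 0 ≤ α)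
    (hquery : ∀ φ : Query X, μ.real {θ | τ < |expect (P θ) φ - expect Q φ|} ≤ η)
    (hball : ∀ R : stdSimplex ℝ X, μ.real {θ | tvDist R.1 (P θ) < ε} ≤ η) (q : ℕ) :
    α * μ.real {θ | A.Learns ℙ α ε τ q (P θ)} ≤ (q + 1) * η := by
  have hdetects : MeasurableSet {p : T × Ω | (A.alg p.2).Detects Q τ ε (P p.1) q 0 Fin.elim0} :=
    measurableSet_preimage (f := fun p : T × Ω ↦ ((p.2, (Fin.elim0 : Fin 0 → ℝ)), p.1))
      (by fun_prop) (A.measurableSet_detects hP Q τ ε q 0)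
  refine mul_measureReal_le_of_le_measureReal_section (ℙ := ℙ) hdetects hα (by positivity)
    (fun θ hθ ↦ ?_) fun ω ↦ (A.alg ω).measureReal_detects_le hη hquery hball q 0 Fin.elim0
  exact (hθ _ (measurable_maskedOracle τ Q (P θ)) (isStatOracle_maskedOracle hτ Q (P θ))).trans
    (measureReal_mono fun ω hω ↦ SQAlgorithm.Succeeds.detects hω)

end Measure

end StatisticalQueries

theorem LevyConcentration.measureReal_le_abs_sub_integral_le {M : ℕ} {κ : ℝ}
    {Θ : Set (ParamSphere M)} (h : LevyConcentration κ Θ) {f : ParamSphere M → ℝ} {K s : ℝ}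
    (hK : 0 < K) (hs : 0 < s) (hf : ∀ θ ∈ Θ, ∀ θ' ∈ Θ, f θ - f θ' ≤ K * dist θ θ') :
    (uniformOn Θ).real {θ | s ≤ |f θ - ∫ θ', f θ' ∂uniformOn Θ|} ≤
      2 * Real.exp (-(κ * s ^ 2 / K ^ 2 * M)) := by
  have hlip : LipschitzOnWith K.toNNReal f Θ := LipschitzOnWith.of_le_add_mul' K fun θ hθ θ' hθ' ↦
    sub_le_iff_le_add'.1 (hf θ hθ θ' hθ')
  convert h f K.toNNReal (Real.toNNReal_pos.2 hK) hlip s hs using 4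
  rw [Real.coe_toNNReal K hK.le]
  ring

namespace LindbladianEnsemble

variable {n X : Type*} [Fintype n] [DecidableEq n] [Fintype X] {M : ℕ} {δ C_G : ℝ}
  (E : LindbladianEnsemble n X M δ C_G)

instance isProbabilityMeasure_μ : IsProbabilityMeasure E.μ :=
  have : IsFiniteMeasure (surfaceMeasure M) :=
    inferInstanceAs (IsFiniteMeasure (Measure.toSphere _))
  ProbabilityTheory.cond_isProbabilityMeasure E.surfaceMeasure_Θ_ne_zero

theorem measurable_outDist (t : ℝ) : Measurable (E.outDist t) :=
  measurable_pi_iff.2 fun x ↦ (E.continuous_outDist t x).measurable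

theorem integrable_outDist (t : ℝ) (x : X) : Integrable (fun θ ↦ E.outDist t θ x) E.μ :=
  (E.continuous_outDist t x).integrable_of_hasCompactSupport (HasCompactSupport.of_compactSpace _)

theorem integral_expect_outDist (t : ℝ) (φ : Query X) :
    ∫ θ, expect (E.outDist t θ) φ ∂E.μ = expect (E.avgDist t) φ := by
  simp only [expect, avgDist]
  rw [integral_finsetSum _ fun x _ ↦ (E.integrable_outDist t x).const_mul _]
  simp_rw [integral_const_mul]

variable {t κ τ : ℝ}

theorem measureReal_le_abs_expect_sub_le (ht : 0 < t) (hδ : 0 < δ) (hC : 0 < C_G) (hτ : 0 < τ)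
    (hE : LevyConcentration κ E.Θ) (φ : Query X) :
    E.μ.real {θ | τ ≤ |expect (E.outDist t θ) φ - expect (E.avgDist t) φ|} ≤
      2 * Real.exp (-(κ * τ ^ 2 / (t * δ * C_G) ^ 2 * M)) := by
  rw [← E.integral_expect_outDist t φ]
  exact hE.measureReal_le_abs_sub_integral_le (by positivity) hτ fun θ hθ θ' hθ' ↦
    (le_abs_self _).trans (E.abs_expect_outDist_sub_le hδ.le hC.le ht.le hθ' hθ φ)

theorem measureReal_lt_abs_expect_sub_le (ht : 0 < t) (hδ : 0 < δ) (hC : 0 < C_G) (hτ : 0 < τ)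
    (hE : LevyConcentration κ E.Θ) (φ : Query X) :
    E.μ.real {θ | τ < |expect (E.outDist t θ) φ - expect (E.avgDist t) φ|} ≤
      2 * Real.exp (-(κ * τ ^ 2 / (t * δ * C_G) ^ 2 * M)) :=
  (measureReal_mono fun _ (hθ : τ < _) ↦ hθ.le).trans
    (E.measureReal_le_abs_expect_sub_le ht hδ hC hτ hE φ)

theorem measureReal_le_abs_tvDist_sub_meanTV_le (ht : 0 < t) (hδ : 0 < δ) (hC : 0 < C_G)
    (hτ : 0 < τ) (hE : LevyConcentration κ E.Θ) :
    E.μ.real {θ | τ / 2 ≤ |tvDist (E.outDist t θ) (E.avgDist t) - E.meanTV t|} ≤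
      2 * Real.exp (-(κ * τ ^ 2 / (t * δ * C_G) ^ 2 * M)) := by
  have hlip : ∀ θ ∈ E.Θ, ∀ θ' ∈ E.Θ, tvDist (E.outDist t θ) (E.avgDist t) -
      tvDist (E.outDist t θ') (E.avgDist t) ≤ t * δ * C_G / 2 * dist θ θ' := by
    intro θ hθ θ' hθ'
    obtain ⟨φ, hφ⟩ := exists_query_expect_sub_eq (E.outDist t θ) (E.outDist t θ')
    have hquery := (le_abs_self _).trans
      (E.abs_expect_outDist_sub_le hδ.le hC.le ht.le hθ' hθ φ)
    have htriangle := tvDist_triangle (E.outDist t θ) (E.outDist t θ') (E.avgDist t)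
    linarith
  have hexponent : κ * (τ / 2) ^ 2 / (t * δ * C_G / 2) ^ 2 = κ * τ ^ 2 / (t * δ * C_G) ^ 2 := by
    field_simp
  rw [← hexponent]
  exact hE.measureReal_le_abs_sub_integral_le (by positivity) (half_pos hτ) hlip

theorem measureReal_tvDist_lt_le (ht : 0 < t) (hδ : 0 < δ) (hC : 0 < C_G) (hτ : 0 < τ)
    (hE : LevyConcentration κ E.Θ) {ε : ℝ} (hmean : 2 * ε + τ ≤ E.meanTV t) (R : X → ℝ) :
    E.μ.real {θ | tvDist R (E.outDist t θ) < ε} ≤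
      2 * Real.exp (-(κ * τ ^ 2 / (t * δ * C_G) ^ 2 * M)) := by
  rcases le_or_gt (ε + τ / 2) (tvDist R (E.avgDist t)) with hR | hR
  · -- A hypothesis far from `Q` and close to `P` yields a query that separates `P` from `Q`.
    obtain ⟨φ, hφ⟩ := exists_query_expect_sub_eq R (E.avgDist t)
    refine (measureReal_mono fun θ (hθ : tvDist R (E.outDist t θ) < ε) ↦ ?_).trans
      (E.measureReal_le_abs_expect_sub_le ht hδ hC hτ hE φ)
    have hquery := (le_abs_self _).trans (abs_expect_sub_le R (E.outDist t θ) φ)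
    refine le_trans ?_ (le_abs_self (expect (E.outDist t θ) φ - expect (E.avgDist t) φ))
    linarith
  · -- A hypothesis close to both `P` and `Q` makes `d_TV(P, Q)` smaller than its mean.
    refine (measureReal_mono fun θ (hθ : tvDist R (E.outDist t θ) < ε) ↦ ?_).trans
      (E.measureReal_le_abs_tvDist_sub_meanTV_le ht hδ hC hτ hE)
    have htriangle := tvDist_triangle (E.outDist t θ) R (E.avgDist t)
    rw [tvDist_comm _ R] at htriangle
    refine le_trans ?_ (neg_le_abs (tvDist (E.outDist t θ) (E.avgDist t) - E.meanTV t))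
    linarith

theorem measureReal_learns_le (ht : 0 < t) (hδ : 0 < δ) (hC : 0 < C_G) (hτ : 0 < τ)
    (hE : LevyConcentration κ E.Θ) {ε : ℝ} (hmean : 2 * ε + τ ≤ E.meanTV t) (A : SQAlgorithm X)
    (q : ℕ) :
    E.μ.real {θ | A.Learns ε τ q (E.outDist t θ)} ≤
      (q + 1) * (2 * Real.exp (-(κ * τ ^ 2 / (t * δ * C_G) ^ 2 * M))) :=
  A.measureReal_learns_le (by positivity) hτ.le
    (fun φ ↦ E.measureReal_lt_abs_expect_sub_le ht hδ hC hτ hE φ)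
    (fun R ↦ E.measureReal_tvDist_lt_le ht hδ hC hτ hE hmean R.1) q

theorem mul_measureReal_learns_le (ht : 0 < t) (hδ : 0 < δ) (hC : 0 < C_G) (hτ : 0 < τ)
    (hE : LevyConcentration κ E.Θ) {ε : ℝ} (hmean : 2 * ε + τ ≤ E.meanTV t) {Ω : Type*}
    [MeasurableSpace Ω] {ℙ : Measure Ω} [IsProbabilityMeasure ℙ] (A : RandomizedSQAlgorithm Ω X)
    {α : ℝ} (hα : 0 ≤ α) (q : ℕ) :
    α * E.μ.real {θ | A.Learns ℙ α ε τ q (E.outDist t θ)} ≤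
      (q + 1) * (2 * Real.exp (-(κ * τ ^ 2 / (t * δ * C_G) ^ 2 * M))) :=
  A.mul_measureReal_learns_le (E.measurable_outDist t) (by positivity) hτ.le hα
    (fun φ ↦ E.measureReal_lt_abs_expect_sub_le ht hδ hC hτ hE φ)
    (fun R ↦ E.measureReal_tvDist_lt_le ht hδ hC hτ hE hmean R.1) q

end LindbladianEnsemble

theorem mul_exp_le_of_le_succ_mul {b x : ℝ} {q : ℕ} (hb : 2 * Real.exp (-x) < b)
    (h : b ≤ (q + 1) * (2 * Real.exp (-x))) : 1 / 4 * b * Real.exp x ≤ q := by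
  have hq : (1 : ℝ) ≤ q := by
    rcases Nat.eq_zero_or_pos q with rfl | hq
    · norm_num at h
      linarith [Real.exp_pos (-x)]
    · exact_mod_cast hq
  calc 1 / 4 * b * Real.exp x
      ≤ 1 / 4 * ((q + q) * (2 * Real.exp (-x))) * Real.exp x := by
        gcongr
        exact h.trans (by gcongr)
    _ = q * (Real.exp (-x) * Real.exp x) := by ring
    _ = q := by rw [← Real.exp_add, neg_add_cancel, Real.exp_zero, mul_one]

theorem tendsto_two_mul_exp_neg_mul_natCast {c : ℝ} (hc : 0 < c) :
    Tendsto (fun M : ℕ ↦ 2 * Real.exp (-(c * M))) atTop (𝓝 0) := by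
  have h : Tendsto (fun M : ℕ ↦ c * (M : ℝ)) atTop atTop :=
    tendsto_natCast_atTop_atTop.const_mul_atTop hc
  simpa using (Real.tendsto_exp_neg_atTop_nhds_zero.comp h).const_mul 2

theorem mainTheorem4_general :
    (∃ κ : ℝ, 0 < κ ∧ ∀ M : ℕ, 1 ≤ M → ∀ Θ : Set (ParamSphere M),
      surfaceMeasure M Θᶜ = 0 → LevyConcentration κ Θ) ∧
    ∀ (t δ C_G κ ε τ α β : ℝ),
      0 < t → 0 < δ → 0 < C_G → 0 < κ → 0 < τ → 0 < α → 0 < β →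
      ∀ᶠ M : ℕ in atTop,
        ∀ (n X : Type*) [Fintype n] [DecidableEq n] [Fintype X]
          (E : LindbladianEnsemble n X M δ C_G),
          LevyConcentration κ E.Θ →
          2 * ε + τ ≤ E.meanTV t →
          (∀ (q : ℕ) (A : SQAlgorithm X),
            β ≤ E.μ.real {θ | SQAlgorithm.Learns A ε τ q (E.outDist t θ)} →
            1 / 4 * β * Real.exp (κ * τ ^ 2 / (t * δ * C_G) ^ 2 * M) ≤ q) ∧
          (∀ (q : ℕ) (Ω : Type*) [MeasurableSpace Ω] (ℙ : Measure Ω) [IsProbabilityMeasure ℙ]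
            (A : RandomizedSQAlgorithm Ω X),
            β ≤ E.μ.real {θ | A.Learns ℙ α ε τ q (E.outDist t θ)} →
            1 / 4 * (α * β) * Real.exp (κ * τ ^ 2 / (t * δ * C_G) ^ 2 * M) ≤ q) := by
  refine ⟨⟨_, div_pos (pow_pos gaussianAbsMoment_pos 2) (by positivity), fun M hM Θ hΘ ↦
    levyConcentration_of_measure_compl_eq_zero hM hΘ⟩, ?_⟩
  intro t δ C_G κ ε τ α β ht hδ hC hκ hτ hα hβ
  have hexp := tendsto_two_mul_exp_neg_mul_natCast (c := κ * τ ^ 2 / (t * δ * C_G) ^ 2)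
    (by positivity)
  filter_upwards [hexp.eventually_lt_const hβ, hexp.eventually_lt_const (mul_pos hα hβ)]
    with M hMβ hMαβ n X _ _ _ E hE hmean
  refine ⟨fun q A hA ↦ ?_, fun q Ω _ ℙ _ A hA ↦ ?_⟩
  · exact mul_exp_le_of_le_succ_mul hMβ
      (hA.trans (E.measureReal_learns_le ht hδ hC hτ hE hmean A q))
  · exact mul_exp_le_of_le_succ_mul hMαβ ((mul_le_mul_of_nonneg_left hA hα.le).trans
      (E.mul_measureReal_learns_le ht hδ hC hτ hE hmean A hα.le q))

theorem mainTheorem4 :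
    -- Lévy concentration holds, with an absolute constant, when `Θ` has full measure in the sphere
    (∃ κ : ℝ, 0 < κ ∧ ∀ M : ℕ, 1 ≤ M → ∀ Θ : Set (ParamSphere M), MeasurableSet Θ →
      surfaceMeasure M Θᶜ = 0 → LevyConcentration κ Θ) ∧
    -- the lower bounds, for all ensembles with Lévy concentration and the mean TV assumption
    ∀ (t δ C_G κ m₀ ε τ α β : ℝ) (εmean : ℕ → ℝ),
      0 < t → 0 < δ → 0 < C_G → 0 < κ → 0 < m₀ → 0 < ε → 0 < τ → 2 * ε + τ < m₀ →
      1 / 2 < α → 0 < β → Tendsto εmean atTop (𝓝 0) →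
      ∀ᶠ M : ℕ in atTop,
        ∀ (n X : Type*) [Fintype n] [DecidableEq n] [Fintype X]
          (E : LindbladianEnsemble n X M δ C_G),
          LevyConcentration κ E.Θ →
          |E.meanTV t - m₀| ≤ εmean M →
          (∀ (q : ℕ) (A : SQAlgorithm X),
            β ≤ E.μ.real {θ | SQAlgorithm.Learns A ε τ q (E.outDist t θ)} →
            1 / 8 * β * Real.exp (κ * τ ^ 2 / (t * δ * C_G) ^ 2 * M) ≤ q) ∧
          (∀ (q : ℕ) (Ω : Type*) [MeasurableSpace Ω] (ℙ : Measure Ω) [IsProbabilityMeasure ℙ]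
            (A : RandomizedSQAlgorithm Ω X),
            β ≤ E.μ.real {θ | A.Learns ℙ α ε τ q (E.outDist t θ)} →
            1 / 8 * (α - 1 / 2) * β * Real.exp (κ * τ ^ 2 / (t * δ * C_G) ^ 2 * M) ≤ q) := by
  obtain ⟨⟨κ₀, hκ₀, hlevy⟩, hlower⟩ := mainTheorem4_general
  refine ⟨⟨κ₀, hκ₀, fun M hM Θ _ ↦ hlevy M hM Θ⟩, ?_⟩
  intro t δ C_G κ m₀ ε τ α β εmean ht hδ hC hκ _ _ hτ hm hα hβ hlim
  filter_upwards [hlower t δ C_G κ ε τ α β ht hδ hC hκ hτ (by linarith) hβ,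
    hlim.eventually_le_const (sub_pos.2 hm)] with M hM hεmean n X _ _ _ E hE hmean
  obtain ⟨hdet, hrand⟩ := hM n X E hE (by linarith [(abs_le.1 hmean).1])
  refine ⟨fun q A hA ↦ le_trans ?_ (hdet q A hA),
    fun q Ω _ ℙ _ A hA ↦ le_trans ?_ (hrand q Ω ℙ A hA)⟩
  · gcongr
    norm_num
  · gcongr ?_ * _
    nlinarith
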